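/- Let $C$ be a closed smooth manifold with a contact form $\alpha_0$ and a fixed auxiliary Riemannian metric, let $\delta>0$, let $D^2(\delta)\subset\mathbb R^2$ be the disc of radius $\delta$ with polar coordinates $(r,\theta)$, and let $\pi: C\times D^2(\delta)\to D^2(\delta)$ be the product contact fibration with its standard contact form $\alpha=\alpha_0+r^2d\theta$. Then there is a constant $\epsilon>0$ with the following property. Let $g=\{g_t\}_{t\in[0,1]}$, $g_t:C\to\mathbb R$, be any smooth time-dependent Hamiltonian function with $|g|\le\epsilon$ and $|dg|\le\epsilon$, where $t$ is regarded as one more coordinate, that is, $dg$ is the differential of $g$ on $[0,1]\times C$, measured with the product metric. Then there is a contact form $\overline\alpha$ on $C\times D^2(\delta)$, for which $\pi$ is still a contact fibration (the fibres are contact submanifolds), such that: (1) $\overline\alpha$ is isotopic to $\alpha$: there is a smooth family $(\beta_s)_{s\in[0,1]}$ of contact forms on $C\times D^2(\delta)$ equal to $\alpha$ for $s=0$ and to $\overline\alpha$ for $s=1$; and the deformation is supported in the sector $S=\{\delta/4\le r\le 3\delta/4,\ -\pi/4\le\theta\le\pi/4\}$: every $\beta_s$ coincides with $\alpha$ outside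 $C\times S$. (2) The monodromy of $\overline\alpha$ along the radial path $\gamma:[0,\delta]\to D^2(\delta)$, given in polar coordinates by $\gamma(t)=\left(\tfrac12\left(t+\tfrac12\delta\right),0\right)$, is the contactomorphism of $C$ generated by $\{g_t\}$, the fibres of $\pi$ being identified with $C$. Here the monodromy along $\gamma$ sends a point $p$ of $\pi^{-1}(\gamma(0))$ to the end point of the unique lift of $\gamma$ that starts at $p$ and is tangent to the contact connection $(\ker d\pi\cap\ker\overline\alpha)^{\perp d\overline\alpha}\subset\ker\overline\alpha$. The contactomorphism generated by $\{g_t\}$ is the time-one map $\phi_1$ of the flow $\partial_t\phi_t=X_t(\phi_t)$, $\phi_0=\mathrm{id}$, where $X_t$ is the vector field on $C$ with $i_{X_t}\alpha_0=g_t$ and $i_{X_t}d\alpha_0=(d_Rg_t)\,\alpha_0-dg_t$, and $R$ is the Reeb vector field of $\alpha_0$. -/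

import Mathlib

open Set
open scoped Manifold ContDiff

section ContactGeometry

variable {E : Type*} [NormedAddCommGroup E] [NormedSpace ℝ E]
  {H : Type*} [TopologicalSpace H] (I : ModelWithCorners ℝ E H)
  {M : Type*} [TopologicalSpace M] [ChartedSpace H M]
  {F : Type*} [NormedAddCommGroup F] [NormedSpace ℝ F]
  {G : Type*} [TopologicalSpace G] (J : ModelWithCorners ℝ F G)
  {B : Type*} [TopologicalSpace B] [ChartedSpace G B]

/-- A (not necessarily smooth) differential 1-form on the manifold `M`. -/
abbrev OneForm (M : Type*) [TopologicalSpace M] [ChartedSpace H M] : Type _ :=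
  (p : M) → TangentSpace I p →L[ℝ] ℝ

variable {I}

/-- The family of 1-forms `A s`, `s ∈ T`, is smooth on `T × U`, jointly in the parameter and the
point, as a map into the cotangent bundle. -/
def SmoothFamilyOn [IsManifold I 1 M] (A : ℝ → OneForm I M) (T : Set ℝ) (U : Set M) : Prop :=
  ContMDiffOn (𝓘(ℝ, ℝ).prod I) (I.prod 𝓘(ℝ, E →L[ℝ] ℝ)) ∞
    (fun q : ℝ × M ↦ (Bundle.TotalSpace.mk' (E →L[ℝ] ℝ) q.2 (A q.1 q.2) :
      Bundle.TotalSpace (E →L[ℝ] ℝ) (fun p : M ↦ TangentSpace I p →L[ℝ] ℝ)))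
    (T ×ˢ U)

/-- The 1-form `α` is smooth on `U`, as a section of the cotangent bundle. -/
def OneForm.SmoothOn [IsManifold I 1 M] (α : OneForm I M) (U : Set M) : Prop :=
  ContMDiffOn I (I.prod 𝓘(ℝ, E →L[ℝ] ℝ)) ∞
    (fun p : M ↦ (Bundle.TotalSpace.mk' (E →L[ℝ] ℝ) p (α p) :
      Bundle.TotalSpace (E →L[ℝ] ℝ) (fun p : M ↦ TangentSpace I p →L[ℝ] ℝ)))
    U

/-- The 1-form `α` read in the preferred chart at `p`: its pullback under the inverse chart. -/
noncomputable def OneForm.inChart (α : OneForm I M) (p : M) (y : E) : E →L[ℝ] ℝ :=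
  (α ((extChartAt I p).symm y)).comp
    (mfderivWithin 𝓘(ℝ, E) I (extChartAt I p).symm (range I) y)

/-- The exterior derivative `dα_p(u, v)`, with the convention
`dα(X, Y) = X(α(Y)) - Y(α(X)) - α([X, Y])`, computed in the preferred chart at `p` (through which
`T_pM` is identified with the model space). -/
noncomputable def OneForm.d (α : OneForm I M) (p : M) (u v : TangentSpace I p) : ℝ :=
  (fderivWithin ℝ (α.inChart p) (range I) (extChartAt I p p) u) v
    - (fderivWithin ℝ (α.inChart p) (range I) (extChartAt I p p) v) u

/-- `α` is a contact form on the open set `U`: a smooth, nowhere vanishing 1-form such that `dα` is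
nondegenerate on the hyperplanes `ker α` (in dimension `2n+1` this says `α ∧ (dα)ⁿ ≠ 0`). -/
def OneForm.IsContactOn [IsManifold I 1 M] (α : OneForm I M) (U : Set M) : Prop :=
  α.SmoothOn U ∧ ∀ p ∈ U, α p ≠ 0 ∧
    ∀ u : TangentSpace I p, α p u = 0 →
      (∀ w : TangentSpace I p, α p w = 0 → α.d p u w = 0) → u = 0

/-- The differential `dh` of a function, as a 1-form. -/
noncomputable def differential (h : M → ℝ) : OneForm I M :=
  fun p ↦ mfderiv I 𝓘(ℝ, ℝ) h p

/-- The differential `dh` of a function on a set `S` (one-sided at the boundary of `S`). -/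
noncomputable def differentialWithin (h : M → ℝ) (S : Set M) : OneForm I M :=
  fun p ↦ mfderivWithin I 𝓘(ℝ, ℝ) h S p

/-- `R` is the value at `p` of the Reeb vector field of `α`. -/
def OneForm.IsReebVector (α : OneForm I M) (p : M) (R : TangentSpace I p) : Prop :=
  α p R = 1 ∧ ∀ w : TangentSpace I p, α.d p R w = 0

/-- `X` is the value at `p` of the contact Hamiltonian vector field of `h`:
`i_X α = h` and `i_X dα = (d_R h) α - dh`, with `R` the Reeb field. -/
def OneForm.IsHamiltonianVector (α : OneForm I M) (h : M → ℝ) (p : M)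
    (X : TangentSpace I p) : Prop :=
  α p X = h p ∧ ∃ R : TangentSpace I p, α.IsReebVector p R ∧
    ∀ w : TangentSpace I p, α.d p X w =
      differential h p R * α p w - differential h p w

/-- The curve `c` has, at the time `t ∈ [a, b]`, the velocity `v` (one-sided at `a` and `b`). -/
def HasVelocity (c : ℝ → M) (a b t : ℝ) (v : TangentSpace I (c t)) : Prop :=
  HasMFDerivWithinAt 𝓘(ℝ, ℝ) I c (Icc a b) t ((1 : ℝ →L[ℝ] ℝ).smulRight v)

/-- `φ t`, `t ∈ [0, 1]`, is the flow, starting at the identity, of the time-dependent contact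
Hamiltonian `g t`; the contactomorphism generated by `g` is then `φ 1`. -/
def OneForm.IsHamiltonianFlow (α : OneForm I M) (g : ℝ → M → ℝ) (φ : ℝ → M → M) : Prop :=
  (∀ p, φ 0 p = p) ∧
  ∀ p, ∀ t ∈ Icc (0 : ℝ) 1, ∃ X : TangentSpace I (φ t p),
    α.IsHamiltonianVector (g t) (φ t p) X ∧
      HasVelocity (I := I) (fun s ↦ φ s p) 0 1 t X

/-- The vertical vectors at `p`, tangent to the fibre of `π : M → B`. -/
def IsVertical (π : M → B) (p : M) (v : TangentSpace I p) : Prop :=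
  mfderiv I J π p v = 0

/-- `π : U → B` is a contact fibration for `α`: `α` is a contact form on the total space `U`, and it
restricts to a contact form on every fibre. -/
def OneForm.IsContactFibrationOn [IsManifold I 1 M] (α : OneForm I M) (π : M → B)
    (U : Set M) : Prop :=
  α.IsContactOn U ∧ ∀ p ∈ U,
    (∃ v : TangentSpace I p, IsVertical J π p v ∧ α p v ≠ 0) ∧
    ∀ u : TangentSpace I p, IsVertical J π p u → α p u = 0 →
      (∀ w : TangentSpace I p, IsVertical J π p w → α p w = 0 → α.d p u w = 0) → u = 0

/-- `v` lies in the contact connection at `p`: the `dα`-orthogonal, inside `D = ker α`, of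
`D ∩ T(fibre)`. -/
def OneForm.IsHorizontal (α : OneForm I M) (π : M → B) (p : M) (v : TangentSpace I p) : Prop :=
  α p v = 0 ∧ ∀ w : TangentSpace I p, IsVertical J π p w → α p w = 0 → α.d p v w = 0

/-- `c : [a, b] → M` is a horizontal lift of the path `γ : [a, b] → B`. -/
def OneForm.IsHorizontalLift (α : OneForm I M) (π : M → B) (γ : ℝ → B) (a b : ℝ)
    (c : ℝ → M) : Prop :=
  ∀ t ∈ Icc a b, π (c t) = γ t ∧
    ∃ v : TangentSpace I (c t), HasVelocity (I := I) c a b t v ∧ α.IsHorizontal J π (c t) v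

/-- `m`, as a map from the fibre over `γ a` to the fibre over `γ b`, is the monodromy of the contact
connection along `γ : [a, b] → B`: through every point `p` of the initial fibre there is a
horizontal lift of `γ`, and all of these lifts end at `m p`. -/
def OneForm.IsMonodromy (α : OneForm I M) (π : M → B) (γ : ℝ → B) (a b : ℝ)
    (m : M → M) : Prop :=
  ∀ p, π p = γ a →
    (∃ c : ℝ → M, α.IsHorizontalLift J π γ a b c ∧ c a = p) ∧
    ∀ c : ℝ → M, α.IsHorizontalLift J π γ a b c → c a = p → c b = m p

/-- `A s`, `s ∈ [0, 1]`, is an isotopy of contact forms on `U` from `α` to `β`, and the deformation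
is supported in `K`. -/
def IsContactIsotopyOn [IsManifold I 1 M] (α β : OneForm I M) (A : ℝ → OneForm I M)
    (U K : Set M) : Prop :=
  SmoothFamilyOn A (Icc 0 1) U ∧
  (∀ s ∈ Icc (0 : ℝ) 1, (A s).IsContactOn U) ∧
  A 0 = α ∧ A 1 = β ∧
  ∀ s ∈ Icc (0 : ℝ) 1, ∀ p ∉ K, A s p = α p

end ContactGeometry

section Product

/-- The Euclidean plane. -/
abbrev Plane : Type := EuclideanSpace ℝ (Fin 2)

/-- The form `r² dθ = x dy - y dx` on the plane, at the point `(x, y)`. -/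
noncomputable def rSqDTheta (x : Plane) : Plane →L[ℝ] ℝ :=
  x 0 • (EuclideanSpace.proj 1 : Plane →L[ℝ] ℝ) - x 1 • (EuclideanSpace.proj 0 : Plane →L[ℝ] ℝ)

/-- The sector `[δ/4, 3δ/4] × [-π/4, π/4]` of the disc of radius `δ`, in polar coordinates. -/
def sector (δ : ℝ) : Set Plane :=
  {x | ∃ r ∈ Icc (δ / 4) (3 * δ / 4), ∃ θ ∈ Icc (-(Real.pi / 4)) (Real.pi / 4),
    x = !₂[r * Real.cos θ, r * Real.sin θ]}

/-- The radial path `t ↦ (r, θ) = ((t + δ/2)/2, 0)`, for `t ∈ [0, δ]`. -/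
noncomputable def radialPath (δ : ℝ) (t : ℝ) : Plane :=
  !₂[(1 / 2) * (t + (1 / 2) * δ), 0]

variable {E : Type*} [NormedAddCommGroup E] [NormedSpace ℝ E]
  {C : Type*} [TopologicalSpace C] [ChartedSpace E C]

/-- The standard form `α₀ + r² dθ` of the product contact fibration, written down on all of `C × ℝ²`;
the total space `C × D²(δ)` is its open subset `univ ×ˢ Metric.ball 0 δ`. -/
noncomputable def stdProductForm (α₀ : OneForm 𝓘(ℝ, E) C) :
    OneForm (𝓘(ℝ, E).prod 𝓘(ℝ, Plane)) (C × Plane) :=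
  fun q ↦ ((α₀ q.1 : E →L[ℝ] ℝ).comp (ContinuousLinearMap.fst ℝ E Plane)
    + (rSqDTheta q.2).comp (ContinuousLinearMap.snd ℝ E Plane) : E × Plane →L[ℝ] ℝ)

/-- `g : [0, 1] × C → ℝ` is smooth, and `|g| ≤ ε`, `|dg| ≤ ε`, where the time is one of the
coordinates: `dg` is the differential on `[0, 1] × C`, measured by the product metric `dt² + m`. -/
def IsSmallHamiltonian [IsManifold 𝓘(ℝ, E) ∞ C]
    (m : Bundle.ContMDiffRiemannianMetric 𝓘(ℝ, E) ∞ E (fun p : C ↦ TangentSpace 𝓘(ℝ, E) p))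
    (ε : ℝ) (g : ℝ → C → ℝ) : Prop :=
  ContMDiffOn (𝓘(ℝ, ℝ).prod 𝓘(ℝ, E)) 𝓘(ℝ, ℝ) ∞ (fun q : ℝ × C ↦ g q.1 q.2)
    (Icc 0 1 ×ˢ univ) ∧
  ∀ t ∈ Icc (0 : ℝ) 1, ∀ p : C, |g t p| ≤ ε ∧
    ∀ (τ : ℝ) (v : TangentSpace 𝓘(ℝ, E) p),
      |differentialWithin (I := 𝓘(ℝ, ℝ).prod 𝓘(ℝ, E)) (fun q : ℝ × C ↦ g q.1 q.2)
          (Icc 0 1 ×ˢ univ) (t, p) (τ, v)|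
        ≤ ε * √(τ ^ 2 + m.inner p v v)

end Product

/-! Take `αbar = α₀ + r² dθ - h dx` with `h(p, x, y) = χ(y) σ'(x) g_{σ(x)}(p)`. Here `σ` is a smooth
step from 0 to 1 on `[3δ/8, 5δ/8]` and `χ` is a bump at 0 with `χ(0) = 1`, vanishing for `|y| ≥
δ/8`. Thus `h` vanishes outside the sector, and `α₀ + r² dθ - s h dx` is the isotopy.

Contact condition. The differential is `dα₀ + 2 dx∧dy - dh∧dx`. Testing against lifts of the two
coordinate directions along the Reeb field `R` shows that the form is contact wherever `2 + ∂_y h -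
x dh(R) ≠ 0` (`IsContactPair.perturbed_nondegenerate`, `isContactOn_perturbedForm`). Since `dx∧dx =
0`, the derivative of `h` in `x`, and with it `σ''`, never enters. By compactness of `C` the metric
bounds `R`, so a small `g` makes both correction terms small, uniformly in `s ∈ [0, 1]`. On fibres
the form restricts to `α₀`, so the fibration condition costs nothing.

Monodromy. On `y = 0` the form `r² dθ` kills `∂_x`. A lift `V + ½∂_x` of the radial velocity is
therefore horizontal iff `α₀(V) = h/2` and `dα₀(V, ·) = -dh/2` on `ker α₀`, that is, iff `V` is the
contact Hamiltonian vector of `h/2`. With `κ(t) = σ((t + δ/2)/2)` one has `h/2 = κ'(t) g_{κ(t)}`, so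
the lifts are `φ_{κ(t)}(p)`, which run from `p` to `φ_1(p)` (`isHorizontal_radialPath_iff`,
`isMonodromy_perturbedForm`).

The remaining work is existence and uniqueness for these ODEs on `C`. Smoothness of the Hamiltonian
field comes from inverting `u ↦ i_u dα₀ + α₀(u) α₀` in a fixed chart, which requires chart
independence of `d`. Since `g` is given only for `t ∈ [0, 1]`, the flow is found after a periodic
change of time, then carried back to `[0, 1]`. -/

section ChartForms

/-! ### Smoothness of covector and vector fields read in a chart -/

variable {E : Type*} [NormedAddCommGroup E] [NormedSpace ℝ E]
  {H : Type*} [TopologicalSpace H] {I : ModelWithCorners ℝ E H}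
  {M : Type*} [TopologicalSpace M] [ChartedSpace H M]
  {EN : Type*} [NormedAddCommGroup EN] [NormedSpace ℝ EN]
  {HN : Type*} [TopologicalSpace HN] {IN : ModelWithCorners ℝ EN HN}
  {N : Type*} [TopologicalSpace N] [ChartedSpace HN N]

theorem OneForm.inChart_extChartAt (α : OneForm I M) {p₀ p : M}
    (hp : p ∈ (chartAt H p₀).source) :
    α.inChart p₀ (extChartAt I p₀ p) =
      (α p : E →L[ℝ] ℝ).comp
        (mfderivWithin 𝓘(ℝ, E) I (extChartAt I p₀).symm (range I) (extChartAt I p₀ p) :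
          E →L[ℝ] E) := by
  have h : (extChartAt I p₀).symm (extChartAt I p₀ p) = p :=
    (extChartAt I p₀).left_inv (by rwa [extChartAt_source])
  -- The type of `α q` depends on `q`, so the equality of points is eliminated by substitution
  -- instead of rewriting.
  have key : ∀ (q : M) (_ : q = p) (D : E →L[ℝ] E),
      (α q : E →L[ℝ] ℝ).comp D = (α p : E →L[ℝ] ℝ).comp D := by
    rintro q rfl D; rfl
  exact key _ h _

theorem inCoordinates_cotangent [IsManifold I 1 M] {p₀ p : M} (hp : p ∈ (chartAt H p₀).source)
    (η : TangentSpace I p →L[ℝ] ℝ) :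
    ContinuousLinearMap.inCoordinates E (TangentSpace I : M → Type _) ℝ (Bundle.Trivial M ℝ)
        p₀ p p₀ p η =
      (η : E →L[ℝ] ℝ).comp
        (mfderivWithin 𝓘(ℝ, E) I (extChartAt I p₀).symm (range I) (extChartAt I p₀ p) :
          E →L[ℝ] E) := by
  have hp' : p ∈ (trivializationAt E (TangentSpace I : M → Type _) p₀).baseSet := by simpa using hp
  have h2 : p ∈ (trivializationAt ℝ (Bundle.Trivial M ℝ) p₀).baseSet := by simp
  have h3 := TangentBundle.symmL_trivializationAt (I := I) hp
  rw [ContinuousLinearMap.inCoordinates, h3]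
  ext v
  simp
  rfl

/-- A family of cotangent vectors is smooth iff it is smooth when read in a chart. -/
theorem contMDiffWithinAt_cotangent_iff [IsManifold I 1 M] (f : N → M) (A : N → OneForm I M)
    {s : Set N} {x₀ : N} (hf : ContMDiffWithinAt IN I ∞ f s x₀) (hx₀ : x₀ ∈ s) :
    ContMDiffWithinAt IN (I.prod 𝓘(ℝ, E →L[ℝ] ℝ)) ∞
      (fun x ↦ (Bundle.TotalSpace.mk' (E →L[ℝ] ℝ) (f x) (A x (f x)) :
        Bundle.TotalSpace (E →L[ℝ] ℝ) (fun p : M ↦ TangentSpace I p →L[ℝ] ℝ))) s x₀ ↔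
    ContMDiffWithinAt IN 𝓘(ℝ, E →L[ℝ] ℝ) ∞
      (fun x ↦ (A x).inChart (f x₀) (extChartAt I (f x₀) (f x))) s x₀ := by
  have h := contMDiffWithinAt_hom_bundle (IM := IN) (IB := I) (n := ∞) (F₁ := E)
    (E₁ := (TangentSpace I : M → Type _)) (F₂ := ℝ) (E₂ := Bundle.Trivial M ℝ)
    (fun x ↦ (Bundle.TotalSpace.mk' (E →L[ℝ] ℝ) (f x) (A x (f x)) :
        Bundle.TotalSpace (E →L[ℝ] ℝ) (fun p : M ↦ TangentSpace I p →L[ℝ] ℝ))) (s := s) (x₀ := x₀)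
  refine h.trans ?_
  have hev : ∀ᶠ x in nhdsWithin x₀ s, f x ∈ (chartAt H (f x₀)).source :=
    hf.continuousWithinAt.preimage_mem_nhdsWithin
      ((chartAt H (f x₀)).open_source.mem_nhds (mem_chart_source H (f x₀)))
  have heq : (fun x ↦ ContinuousLinearMap.inCoordinates E (TangentSpace I : M → Type _) ℝ
      (Bundle.Trivial M ℝ) (f x₀) (f x) (f x₀) (f x) (A x (f x))) =ᶠ[nhdsWithin x₀ s]
      (fun x ↦ (A x).inChart (f x₀) (extChartAt I (f x₀) (f x))) := by
    filter_upwards [hev] with x hx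
    exact (inCoordinates_cotangent hx _).trans ((A x).inChart_extChartAt hx).symm
  constructor
  · rintro ⟨-, h2⟩
    exact h2.congr_of_eventuallyEq_of_mem heq.symm hx₀
  · intro h2
    exact ⟨hf, h2.congr_of_eventuallyEq_of_mem heq hx₀⟩

/-- A vector field along a map is smooth iff it is smooth when read in a chart. -/
theorem contMDiffAt_tangent_iff [IsManifold I 1 M] {n : ℕ∞ω} (f : N → M)
    (X : ∀ x, TangentSpace I (f x)) {x₀ : N} (hf : ContMDiffAt IN I n f x₀) :
    ContMDiffAt IN I.tangent n (fun x ↦ (⟨f x, X x⟩ : TangentBundle I M)) x₀ ↔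
    ContMDiffAt IN 𝓘(ℝ, E) n
      (fun x ↦ (tangentCoordChange I (f x) (f x₀) (f x) (X x) : E)) x₀ := by
  have h := Bundle.contMDiffAt_totalSpace (IM := IN) (IB := I) (n := n) (F := E)
    (E := (TangentSpace I : M → Type _))
    (f := fun x ↦ (⟨f x, X x⟩ : TangentBundle I M)) (x₀ := x₀)
  refine h.trans ?_
  constructor
  · rintro ⟨-, h2⟩
    exact h2
  · intro h2
    exact ⟨hf, h2⟩

end ChartForms

/-! ### Exterior derivative under change of charts -/

section ChartChange

variable {E : Type*} [NormedAddCommGroup E] [NormedSpace ℝ E]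
  {C : Type*} [TopologicalSpace C] [ChartedSpace E C]

local notation "ψ" => extChartAt 𝓘(ℝ, E)
local notation "Tc" => tangentCoordChange 𝓘(ℝ, E)

theorem tangentCoordChange_comp_eq_self [IsManifold 𝓘(ℝ, E) 1 C] {p₀ p₁ p : C}
    (h₀ : p ∈ (chartAt E p₀).source) (h₁ : p ∈ (chartAt E p₁).source) (v : E) :
    Tc p₁ p₀ p (Tc p₀ p₁ p v) = v := by
  have h₀' : p ∈ (ψ p₀).source := by rwa [extChartAt_source]
  have h₁' : p ∈ (ψ p₁).source := by rwa [extChartAt_source]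
  rw [tangentCoordChange_comp ⟨⟨h₀', h₁'⟩, h₀'⟩, tangentCoordChange_self h₀']

theorem OneForm.inChart_extChartAt_eq_comp [IsManifold 𝓘(ℝ, E) 1 C] (α : OneForm 𝓘(ℝ, E) C)
    {p₀ p : C} (hp : p ∈ (chartAt E p₀).source) :
    α.inChart p₀ (ψ p₀ p) = (α p : E →L[ℝ] ℝ).comp (Tc p₀ p p) := by
  rw [α.inChart_extChartAt hp, ← TangentBundle.symmL_trivializationAt hp,
    TangentBundle.symmL_trivializationAt_eq_core hp]
  rfl

theorem OneForm.apply_eq_inChart [IsManifold 𝓘(ℝ, E) 1 C] (α : OneForm 𝓘(ℝ, E) C)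
    {p₀ p : C} (hp : p ∈ (chartAt E p₀).source) (v : E) :
    α p v = α.inChart p₀ (ψ p₀ p) (Tc p p₀ p v) := by
  rw [α.inChart_extChartAt_eq_comp hp]
  change _ = α p (Tc p₀ p p (Tc p p₀ p v))
  rw [tangentCoordChange_comp_eq_self (mem_chart_source E p) hp]

theorem mfderiv_eq_fderiv_chart [IsManifold 𝓘(ℝ, E) 1 C] {h : C → ℝ} {p₀ p : C}
    (hp : p ∈ (chartAt E p₀).source)
    (hh : DifferentiableAt ℝ (h ∘ (ψ p₀).symm) (ψ p₀ p)) (v : E) :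
    mfderiv 𝓘(ℝ, E) 𝓘(ℝ, ℝ) h p v = fderiv ℝ (h ∘ (ψ p₀).symm) (ψ p₀ p) (Tc p p₀ p v) := by
  have hT : mfderiv 𝓘(ℝ, E) 𝓘(ℝ, E) (ψ p₀) p = Tc p p₀ p := by
    rw [← TangentBundle.continuousLinearMapAt_trivializationAt hp,
      TangentBundle.continuousLinearMapAt_trivializationAt_eq_core hp]
  have h1 : HasMFDerivAt 𝓘(ℝ, E) 𝓘(ℝ, E) (ψ p₀) p (Tc p p₀ p) := by
    rw [← hT]
    exact (mdifferentiableAt_extChartAt hp).hasMFDerivAt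
  have h2 := hh.hasFDerivAt.hasMFDerivAt.comp p h1
  have h3 : h =ᶠ[nhds p] ((h ∘ (ψ p₀).symm) ∘ ψ p₀) := by
    filter_upwards [(chartAt E p₀).open_source.mem_nhds hp] with q hq
    simp only [Function.comp_apply]
    rw [(ψ p₀).left_inv (by rwa [extChartAt_source])]
  rw [(h2.congr_of_eventuallyEq h3).mfderiv]
  rfl

theorem eventually_symm_mem_source {p₀ p : C} (hp : p ∈ (chartAt E p₀).source) :
    ∀ᶠ z in nhds (ψ p p), z ∈ (ψ p).target ∧ (ψ p).symm z ∈ (chartAt E p₀).source := by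
  have h1 : (ψ p).target ∈ nhds (ψ p p) := extChartAt_target_mem_nhds p
  have h2 : (ψ p).symm ⁻¹' (chartAt E p₀).source ∈ nhds (ψ p p) := by
    refine (continuousAt_extChartAt_symm p).preimage_mem_nhds ?_
    rw [extChartAt_to_inv p]
    exact (chartAt E p₀).open_source.mem_nhds hp
  filter_upwards [h1, h2] with z hz1 hz2 using ⟨hz1, hz2⟩

/-- Pullbacks compose. The identity is needed on a whole neighbourhood because it is differentiated
to compare `dα` in two charts. -/
theorem OneForm.inChart_transition [IsManifold 𝓘(ℝ, E) 1 C] (α : OneForm 𝓘(ℝ, E) C)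
    {p₀ p : C} (hp : p ∈ (chartAt E p₀).source) :
    ∀ᶠ z in nhds (ψ p p), α.inChart p z =
      (α.inChart p₀ ((ψ p₀ ∘ (ψ p).symm) z)).comp (fderiv ℝ (ψ p₀ ∘ (ψ p).symm) z) := by
  filter_upwards [eventually_symm_mem_source hp] with z hz
  obtain ⟨hz1, hz2⟩ := hz
  set q := (ψ p).symm z with hq
  have hzq : z = ψ p q := ((ψ p).right_inv hz1).symm
  have hqp : q ∈ (chartAt E p).source := by
    rw [← extChartAt_source 𝓘(ℝ, E)]; exact (ψ p).map_target hz1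
  have hqq := mem_chart_source E q
  have hτ : fderiv ℝ (ψ p₀ ∘ (ψ p).symm) z = Tc p p₀ q := by
    rw [tangentCoordChange_def, ← hzq]; simp [fderivWithin_univ]
  rw [hτ, Function.comp_apply, ← hq, hzq, α.inChart_extChartAt_eq_comp hqp,
    α.inChart_extChartAt_eq_comp hz2]
  ext v
  change α q (Tc p q q v) = α q (Tc p₀ q q (Tc p p₀ q v))
  rw [tangentCoordChange_comp]
  simp only [extChartAt_source]
  exact ⟨⟨hqp, hz2⟩, hqq⟩

/-- The exterior derivative of a 1-form on a vector space. -/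
noncomputable def extDerivForm (a : E → E →L[ℝ] ℝ) (y : E) : E →L[ℝ] E →L[ℝ] ℝ :=
  fderiv ℝ a y - (fderiv ℝ a y).flip

omit [ChartedSpace E C] in
theorem extDerivForm_apply (a : E → E →L[ℝ] ℝ) (y u v : E) :
    extDerivForm a y u v = fderiv ℝ a y u v - fderiv ℝ a y v u := rfl

theorem OneForm.d_eq_extDerivForm_self (α : OneForm 𝓘(ℝ, E) C) (p : C) (u v : E) :
    α.d p u v = extDerivForm (α.inChart p) (ψ p p) u v := by
  simp only [OneForm.d, extDerivForm_apply, modelWithCornersSelf_coe, range_id, fderivWithin_univ]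

/-- The exterior derivative may be computed in any chart. -/
theorem OneForm.d_eq_extDerivForm [IsManifold 𝓘(ℝ, E) ∞ C] (α : OneForm 𝓘(ℝ, E) C)
    {p₀ p : C} (hp : p ∈ (chartAt E p₀).source)
    (hα : DifferentiableAt ℝ (α.inChart p₀) (ψ p₀ p)) (u v : E) :
    α.d p u v = extDerivForm (α.inChart p₀) (ψ p₀ p) (Tc p p₀ p u) (Tc p p₀ p v) := by
  rw [α.d_eq_extDerivForm_self]
  set τ := ψ p₀ ∘ (ψ p).symm with hτ
  have hτp : τ (ψ p p) = ψ p₀ p := by simp [hτ]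
  have hτ2 : ContDiffAt ℝ ∞ τ (ψ p p) := by
    have := contDiffWithinAt_ext_coord_change (I := 𝓘(ℝ, E)) (n := ∞) p₀ p (y := ψ p p) (by
      rw [ext_coord_change_source]
      exact ⟨chartAt E p p, ⟨mem_chart_target E p, by simpa using hp⟩, rfl⟩)
    simpa only [modelWithCornersSelf_coe, range_id, contDiffWithinAt_univ] using this
  have hT : fderiv ℝ τ (ψ p p) = Tc p p₀ p := by
    rw [tangentCoordChange_def]; simp [fderivWithin_univ, hτ]
  have hd1 : HasFDerivAt τ (Tc p p₀ p) (ψ p p) := by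
    rw [← hT]; exact (hτ2.differentiableAt (by simp)).hasFDerivAt
  have hd2 : HasFDerivAt (fderiv ℝ τ) (fderiv ℝ (fderiv ℝ τ) (ψ p p)) (ψ p p) :=
    ((hτ2.fderiv_right (m := 1) (WithTop.coe_le_coe.2 le_top)).differentiableAt (by simp)).hasFDerivAt
  -- Differentiating the pullback produces a term with the second derivative of `τ`; being symmetric
  -- in `u` and `v`, it cancels in `d`.
  have hsymm : IsSymmSndFDerivAt ℝ τ (ψ p p) := hτ2.isSymmSndFDerivAt
    (by rw [minSmoothness_of_isRCLikeNormedField]; exact WithTop.coe_le_coe.2 le_top)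
  have hd3 : HasFDerivAt (α.inChart p₀ ∘ τ)
      ((fderiv ℝ (α.inChart p₀) (ψ p₀ p)).comp (Tc p p₀ p)) (ψ p p) := by
    refine HasFDerivAt.comp _ ?_ hd1
    rw [hτp]; exact hα.hasFDerivAt
  have hd4 := hd3.clm_comp hd2
  have hd5 := hd4.congr_of_eventuallyEq (f₁ := α.inChart p)
    (by filter_upwards [α.inChart_transition hp] with z hz using hz)
  rw [extDerivForm_apply, extDerivForm_apply, hd5.fderiv, hT]
  simp only [add_apply, ContinuousLinearMap.comp_apply,
    ContinuousLinearMap.compL_apply, ContinuousLinearMap.flip_apply, hsymm u v]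
  ring

theorem OneForm.SmoothOn.contDiffAt_inChart [IsManifold 𝓘(ℝ, E) ∞ C] {α : OneForm 𝓘(ℝ, E) C}
    (hα : α.SmoothOn univ) (p₀ : C) : ContDiffAt ℝ ∞ (α.inChart p₀) (ψ p₀ p₀) := by
  have h1 := (contMDiffWithinAt_cotangent_iff (IN := 𝓘(ℝ, E)) (fun p : C ↦ p) (fun _ ↦ α)
    (s := univ) (x₀ := p₀) contMDiffWithinAt_id (mem_univ _)).1 (hα p₀ (mem_univ _))
  rw [contMDiffWithinAt_univ] at h1
  have h2 : ContMDiffAt 𝓘(ℝ, E) 𝓘(ℝ, E) ∞ (ψ p₀).symm (ψ p₀ p₀) :=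
    (contMDiffOn_extChartAt_symm p₀).contMDiffAt (extChartAt_target_mem_nhds p₀)
  have h3 := ContMDiffAt.comp_of_eq (x := ψ p₀ p₀) h1 h2 (extChartAt_to_inv p₀)
  rw [contMDiffAt_iff_contDiffAt] at h3
  refine h3.congr_of_eventuallyEq ?_
  filter_upwards [extChartAt_target_mem_nhds (I := 𝓘(ℝ, E)) p₀] with z hz
  simp only [Function.comp_apply]
  rw [(ψ p₀).right_inv hz]

end ChartChange

/-! ### Linear algebra of a contact form at one point -/

section ContactAlgebra

variable {E : Type*} [NormedAddCommGroup E] [NormedSpace ℝ E]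

/-- The pointwise linear algebra of a contact form: a covector `a` and a skew form `b` that is
nondegenerate on the kernel of `a`. -/
structure IsContactPair (a : E →L[ℝ] ℝ) (b : E →L[ℝ] E →L[ℝ] ℝ) : Prop where
  skew : ∀ u v, b u v = -b v u
  ne_zero : a ≠ 0
  nondegenerate : ∀ u, a u = 0 → (∀ w, a w = 0 → b u w = 0) → u = 0

/-- The map `u ↦ i_u b + a(u) a`. -/
noncomputable def contactMap (a : E →L[ℝ] ℝ) (b : E →L[ℝ] E →L[ℝ] ℝ) : E →L[ℝ] E →L[ℝ] ℝ :=
  b + a.smulRight a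

theorem contactMap_apply (a : E →L[ℝ] ℝ) (b : E →L[ℝ] E →L[ℝ] ℝ) (u v : E) :
    contactMap a b u v = b u v + a u * a v := rfl

/-- The Reeb vector of a contact pair. -/
noncomputable def reebVec (a : E →L[ℝ] ℝ) (b : E →L[ℝ] E →L[ℝ] ℝ) : E :=
  (contactMap a b).inverse a

/-- The contact Hamiltonian vector of a function with value `c` and differential `k`. -/
noncomputable def hamVec (a : E →L[ℝ] ℝ) (b : E →L[ℝ] E →L[ℝ] ℝ) (k : E →L[ℝ] ℝ) (c : ℝ) : E :=
  (contactMap a b).inverse ((k (reebVec a b) + c) • a - k)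

namespace IsContactPair

variable {a : E →L[ℝ] ℝ} {b : E →L[ℝ] E →L[ℝ] ℝ}

theorem self_eq_zero (h : IsContactPair a b) (u : E) : b u u = 0 := by
  have := h.skew u u
  linarith

variable [FiniteDimensional ℝ E]

/-- If `i_u b + a(u) a = 0`, evaluation at `u` gives `a(u)² = 0`, and then nondegeneracy on `ker a`
gives `u = 0`. Injectivity suffices because a space and its dual have equal dimension. -/
theorem isInvertible (h : IsContactPair a b) : (contactMap a b).IsInvertible := by
  have hinj : Function.Injective (contactMap a b : E →ₗ[ℝ] (E →L[ℝ] ℝ)) := by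
    rw [← LinearMap.ker_eq_bot, LinearMap.ker_eq_bot']
    intro u hu
    have hu' : ∀ w, b u w + a u * a w = 0 := fun w ↦ by
      rw [← contactMap_apply]
      exact congrArg (fun l : E →L[ℝ] ℝ ↦ l w) hu
    have h0 : a u = 0 := by
      have := hu' u
      rw [h.self_eq_zero] at this
      simpa using this
    refine h.nondegenerate u h0 fun w _ ↦ ?_
    simpa [h0] using hu' w
  have hrank : Module.finrank ℝ E = Module.finrank ℝ (E →L[ℝ] ℝ) := by
    rw [← (LinearMap.toContinuousLinearMap (𝕜 := ℝ) (E := E) (F' := ℝ)).finrank_eq]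
    exact (Subspace.dual_finrank_eq (K := ℝ) (V := E)).symm
  let e := (LinearMap.linearEquivOfInjective _ hinj hrank).toContinuousLinearEquiv
  exact ⟨e, by ext; rfl⟩

theorem contactMap_inverse (h : IsContactPair a b) (l : E →L[ℝ] ℝ) :
    contactMap a b ((contactMap a b).inverse l) = l := by
  obtain ⟨e, he⟩ := h.isInvertible
  rw [← he]
  simp

/-- Evaluating `i_R b + a(R) a = a` at `R` gives `a(R)² = a(R)`. The value 0 would force `R = 0` by
nondegeneracy, hence `a = 0`. -/
theorem reebVec_spec (h : IsContactPair a b) :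
    a (reebVec a b) = 1 ∧ ∀ w, b (reebVec a b) w = 0 := by
  set R := reebVec a b with hR
  have h1 : ∀ w, b R w + a R * a w = a w := fun w ↦ by
    rw [← contactMap_apply, hR, reebVec, h.contactMap_inverse]
  have h2 := h1 R
  rw [h.self_eq_zero, zero_add] at h2
  have h3 : a R * (a R - 1) = 0 := by linarith
  rcases mul_eq_zero.1 h3 with h4 | h4
  · exfalso
    have h5 : R = 0 := h.nondegenerate R h4 fun w hw ↦ by simpa [h4, hw] using h1 w
    refine h.ne_zero ?_
    ext w
    have := h1 w
    rw [h5] at this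
    simpa using this.symm
  · have h5 : a R = 1 := by linarith
    refine ⟨h5, fun w ↦ ?_⟩
    have := h1 w
    rw [h5] at this
    linarith

theorem hamVec_spec (h : IsContactPair a b) (k : E →L[ℝ] ℝ) (c : ℝ) :
    a (hamVec a b k c) = c ∧
      ∀ w, b (hamVec a b k c) w = k (reebVec a b) * a w - k w := by
  set X := hamVec a b k c with hX
  obtain ⟨hR1, hR2⟩ := h.reebVec_spec
  have h1 : ∀ w, b X w + a X * a w = (k (reebVec a b) + c) * a w - k w := fun w ↦ by
    rw [← contactMap_apply, hX, hamVec, h.contactMap_inverse]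
    simp
  -- At the Reeb vector the terms in `k` cancel, leaving `a X = c`.
  have h2 := h1 (reebVec a b)
  rw [h.skew, hR2, hR1] at h2
  have h3 : a X = c := by linarith
  refine ⟨h3, fun w ↦ ?_⟩
  have := h1 w
  rw [h3] at this
  linarith

/-- Two candidates differ by an element of `ker a` that is `b`-orthogonal to `ker a`. Testing on
`ker a` alone is thus enough, which matches what horizontality provides. -/
theorem eq_hamVec (h : IsContactPair a b) {k : E →L[ℝ] ℝ} {c : ℝ} {X : E} (h1 : a X = c)
    (h2 : ∀ w, a w = 0 → b X w = -k w) : X = hamVec a b k c := by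
  obtain ⟨h3, h4⟩ := h.hamVec_spec k c
  rw [← sub_eq_zero]
  refine h.nondegenerate _ (by rw [map_sub, h1, h3, sub_self]) fun w hw ↦ ?_
  rw [map_sub, sub_apply, h2 w hw, h4, hw]
  ring

theorem contDiffAt_hamVec {P : Type*} [NormedAddCommGroup P] [NormedSpace ℝ P]
    {a : P → E →L[ℝ] ℝ} {b : P → E →L[ℝ] E →L[ℝ] ℝ} {k : P → E →L[ℝ] ℝ} {c : P → ℝ} {x : P}
    {n : ℕ∞ω} (h : IsContactPair (a x) (b x)) (ha : ContDiffAt ℝ n a x) (hb : ContDiffAt ℝ n b x)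
    (hk : ContDiffAt ℝ n k x) (hc : ContDiffAt ℝ n c x) :
    ContDiffAt ℝ n (fun y ↦ hamVec (a y) (b y) (k y) (c y)) x := by
  have : CompleteSpace E := FiniteDimensional.complete ℝ E
  have hΦ : ContDiffAt ℝ n (fun y ↦ contactMap (a y) (b y)) x :=
    hb.add (ha.smulRight ha)
  obtain ⟨e, he⟩ := h.isInvertible
  have hinv : ContDiffAt ℝ n (fun y ↦ (contactMap (a y) (b y)).inverse) x := by
    refine ContDiffAt.comp (g := ContinuousLinearMap.inverse) x ?_ hΦ
    rw [← he]
    exact contDiffAt_map_inverse e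
  have hR : ContDiffAt ℝ n (fun y ↦ reebVec (a y) (b y)) x := hinv.clm_apply ha
  exact hinv.clm_apply ((((hk.clm_apply hR).add hc).smul ha).sub hk)

end IsContactPair

end ContactAlgebra

/-! ### The contact Hamiltonian vector field on the manifold -/

theorem contMDiffAt_prod_iff_contDiffAt {E F G : Type*} [NormedAddCommGroup E] [NormedSpace ℝ E]
    [NormedAddCommGroup F] [NormedSpace ℝ F] [NormedAddCommGroup G] [NormedSpace ℝ G]
    {n : ℕ∞ω} {f : E × F → G} {x : E × F} :
    ContMDiffAt (𝓘(ℝ, E).prod 𝓘(ℝ, F)) 𝓘(ℝ, G) n f x ↔ ContDiffAt ℝ n f x := by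
  rw [← contMDiffAt_iff_contDiffAt, modelWithCornersSelf_prod, ← chartedSpaceSelf_prod]

section HamiltonianField

variable {E : Type*} [NormedAddCommGroup E] [NormedSpace ℝ E]
  {C : Type*} [TopologicalSpace C] [ChartedSpace E C] [IsManifold 𝓘(ℝ, E) ∞ C]

local notation "ψ" => extChartAt 𝓘(ℝ, E)
local notation "Tc" => tangentCoordChange 𝓘(ℝ, E)

/-- The exterior derivative at `p`, as a bilinear form. -/
noncomputable def OneForm.dForm (α : OneForm 𝓘(ℝ, E) C) (p : C) : E →L[ℝ] E →L[ℝ] ℝ :=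
  extDerivForm (α.inChart p) (ψ p p)

omit [IsManifold 𝓘(ℝ, E) ∞ C] in
theorem OneForm.d_eq_dForm (α : OneForm 𝓘(ℝ, E) C) (p : C) (u v : E) :
    α.d p u v = α.dForm p u v := α.d_eq_extDerivForm_self p u v

theorem OneForm.IsContactOn.isContactPair {α : OneForm 𝓘(ℝ, E) C} (hα : α.IsContactOn univ)
    (p : C) : IsContactPair (E := E) (α p) (α.dForm p) where
  skew u v := by simp [OneForm.dForm, extDerivForm_apply]
  ne_zero := (hα.2 p (mem_univ p)).1
  nondegenerate u hu hw := (hα.2 p (mem_univ p)).2 u hu fun w hw' ↦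
    (α.d_eq_dForm p u w).trans (hw w hw')

theorem OneForm.SmoothOn.eventually_differentiableAt {α : OneForm 𝓘(ℝ, E) C}
    (hα : α.SmoothOn univ) (p₀ : C) :
    ∀ᶠ p in nhds p₀, DifferentiableAt ℝ (α.inChart p₀) (ψ p₀ p) := by
  have h1 : ContDiffAt ℝ 1 (α.inChart p₀) (ψ p₀ p₀) :=
    (hα.contDiffAt_inChart p₀).of_le (WithTop.coe_le_coe.2 le_top)
  have h2 := h1.eventually (by simp)
  have h3 := (continuousAt_extChartAt (I := 𝓘(ℝ, E)) p₀).eventually h2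
  filter_upwards [h3] with p hp using hp.differentiableAt (by simp)

theorem OneForm.IsContactOn.isContactPair_chart {α : OneForm 𝓘(ℝ, E) C}
    (hα : α.IsContactOn univ) {p₀ p : C} (hp : p ∈ (chartAt E p₀).source)
    (hd : DifferentiableAt ℝ (α.inChart p₀) (ψ p₀ p)) :
    IsContactPair (α.inChart p₀ (ψ p₀ p)) (extDerivForm (α.inChart p₀) (ψ p₀ p)) := by
  have h := hα.isContactPair p
  have hpp := mem_chart_source E p
  have hT : ∀ v, Tc p p₀ p (Tc p₀ p p v) = v := tangentCoordChange_comp_eq_self hp hpp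
  refine ⟨fun u v ↦ by simp [extDerivForm_apply], fun h0 ↦ h.ne_zero ?_, fun u hu hw ↦ ?_⟩
  · refine ContinuousLinearMap.ext fun v ↦ ?_
    have := α.apply_eq_inChart hp v
    rw [h0] at this
    exact this
  · have hu0 : Tc p₀ p p u = 0 := by
      refine h.nondegenerate _ ?_ fun w hw' ↦ ?_
      · exact (α.apply_eq_inChart hp _).trans (by rw [hT]; exact hu)
      · rw [← α.d_eq_dForm, α.d_eq_extDerivForm hp hd, hT]
        exact hw _ ((α.apply_eq_inChart hp w).symm.trans hw')
    rw [← hT u, hu0, map_zero]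

/-- The contact Hamiltonian vector field of the function `h`. -/
noncomputable def OneForm.ham (α : OneForm 𝓘(ℝ, E) C) (h : C → ℝ) (p : C) :
    TangentSpace 𝓘(ℝ, E) p :=
  hamVec (E := E) (α p) (α.dForm p) (mfderiv 𝓘(ℝ, E) 𝓘(ℝ, ℝ) h p) (h p)

variable [FiniteDimensional ℝ E]

/-- The definition of `ham` uses a chart that moves with `p`. In a fixed chart the field is
characterised by the same equations, so uniqueness identifies it with `hamVec` of data that vary
smoothly. -/
theorem OneForm.IsContactOn.ham_in_chart {α : OneForm 𝓘(ℝ, E) C}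
    (hα : α.IsContactOn univ) {p₀ p : C} (hp : p ∈ (chartAt E p₀).source)
    (hd : DifferentiableAt ℝ (α.inChart p₀) (ψ p₀ p)) {h : C → ℝ}
    (hh : DifferentiableAt ℝ (h ∘ (ψ p₀).symm) (ψ p₀ p)) :
    Tc p p₀ p (α.ham h p) = hamVec (α.inChart p₀ (ψ p₀ p))
      (extDerivForm (α.inChart p₀) (ψ p₀ p)) (fderiv ℝ (h ∘ (ψ p₀).symm) (ψ p₀ p)) (h p) := by
  have hpp := mem_chart_source E p
  have hT : ∀ v, Tc p p₀ p (Tc p₀ p p v) = v := tangentCoordChange_comp_eq_self hp hpp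
  obtain ⟨h1, h2⟩ := (hα.isContactPair p).hamVec_spec
    (mfderiv 𝓘(ℝ, E) 𝓘(ℝ, ℝ) h p) (h p)
  refine (hα.isContactPair_chart hp hd).eq_hamVec ?_ fun w hw ↦ ?_
  · exact (α.apply_eq_inChart hp _).symm.trans h1
  · have hw' : α p (Tc p₀ p p w) = 0 := by
      rw [α.apply_eq_inChart hp, hT]; exact hw
    have h3 := h2 (Tc p₀ p p w)
    rw [← α.d_eq_dForm, α.d_eq_extDerivForm hp hd, hT] at h3
    have h4 := mfderiv_eq_fderiv_chart hp hh (Tc p₀ p p w)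
    rw [hT] at h4
    rw [← h4]
    refine h3.trans ?_
    erw [hw', mul_zero, zero_sub]
    rfl

/-- The Hamiltonian vector fields of a smooth family of functions form a smooth family. -/
theorem OneForm.IsContactOn.contMDiff_ham {α : OneForm 𝓘(ℝ, E) C}
    (hα : α.IsContactOn univ) {f : ℝ × C → ℝ}
    (hf : ContMDiff (𝓘(ℝ, ℝ).prod 𝓘(ℝ, E)) 𝓘(ℝ, ℝ) ∞ f) :
    ContMDiff (𝓘(ℝ, ℝ).prod 𝓘(ℝ, E)) (𝓘(ℝ, E)).tangent ∞
      (fun q : ℝ × C ↦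
        (⟨q.2, α.ham (fun p ↦ f (q.1, p)) q.2⟩ : TangentBundle 𝓘(ℝ, E) C)) := by
  rintro ⟨t₀, p₀⟩
  rw [contMDiffAt_tangent_iff (f := fun q : ℝ × C ↦ q.2)
    (X := fun q ↦ α.ham (fun p ↦ f (q.1, p)) q.2) contMDiffAt_snd]
  set F : ℝ → E → ℝ := fun t y ↦ f (t, (ψ p₀).symm y) with hF
  have hFs : ContDiffAt ℝ ∞ (Function.uncurry F) (t₀, ψ p₀ p₀) := by
    rw [← contMDiffAt_prod_iff_contDiffAt]
    have h2 : ContMDiffAt 𝓘(ℝ, E) 𝓘(ℝ, E) ∞ (ψ p₀).symm (ψ p₀ p₀) :=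
      (contMDiffOn_extChartAt_symm p₀).contMDiffAt (extChartAt_target_mem_nhds p₀)
    have h3 : ContMDiffAt (𝓘(ℝ, ℝ).prod 𝓘(ℝ, E)) (𝓘(ℝ, ℝ).prod 𝓘(ℝ, E)) ∞
        (fun q : ℝ × E ↦ (q.1, (ψ p₀).symm q.2)) (t₀, ψ p₀ p₀) :=
      contMDiffAt_fst.prodMk (h2.comp (t₀, ψ p₀ p₀) contMDiffAt_snd)
    exact (hf.contMDiffAt).comp (t₀, ψ p₀ p₀) h3
  have hFd : ∀ᶠ q in nhds (t₀, p₀), DifferentiableAt ℝ (F q.1) (ψ p₀ q.2) := by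
    have h1 := (hFs.of_le (m := 1) (WithTop.coe_le_coe.2 le_top)).eventually (by simp)
    have h2 : ContinuousAt (fun q : ℝ × C ↦ (q.1, ψ p₀ q.2)) (t₀, p₀) :=
      continuousAt_fst.prodMk ((continuousAt_extChartAt (I := 𝓘(ℝ, E)) p₀).comp continuousAt_snd)
    filter_upwards [h2.eventually h1] with q hq
    have h3 : DifferentiableAt ℝ (Function.uncurry F) (q.1, ψ p₀ q.2) :=
      hq.differentiableAt (by simp)
    exact h3.comp (ψ p₀ q.2) ((differentiableAt_const q.1).prodMk differentiableAt_id)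
  have hev : ∀ᶠ q in nhds (t₀, p₀), q.2 ∈ (chartAt E p₀).source :=
    continuousAt_snd.eventually ((chartAt E p₀).open_source.mem_nhds (mem_chart_source E p₀))
  have hsd : ∀ᶠ q in nhds (t₀, p₀), DifferentiableAt ℝ (α.inChart p₀) (ψ p₀ q.2) :=
    (continuousAt_snd (p := (t₀, p₀))).eventually (hα.1.eventually_differentiableAt p₀)
  have ha := hα.1.contDiffAt_inChart p₀
  have hda : ContDiffAt ℝ ∞ (fderiv ℝ (α.inChart p₀)) (ψ p₀ p₀) :=
    ha.fderiv_right (m := ∞) (by simp)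
  have hflip : ContDiff ℝ ∞ (fun l : E →L[ℝ] E →L[ℝ] ℝ ↦ l.flip) := by
    refine IsBoundedLinearMap.contDiff ⟨⟨fun _ _ ↦ rfl, fun _ _ ↦ rfl⟩, 1, one_pos, fun l ↦ ?_⟩
    rw [ContinuousLinearMap.opNorm_flip, one_mul]
  have hdb : ContDiffAt ℝ ∞ (extDerivForm (α.inChart p₀)) (ψ p₀ p₀) :=
    hda.sub (hflip.contDiffAt.comp _ hda)
  have hG : ContDiffAt ℝ ∞ (fun q : ℝ × E ↦ hamVec (α.inChart p₀ q.2)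
      (extDerivForm (α.inChart p₀) q.2) (fderiv ℝ (F q.1) q.2) (F q.1 q.2)) (t₀, ψ p₀ p₀) := by
    refine IsContactPair.contDiffAt_hamVec ?_ ?_ ?_ ?_ ?_
    · exact hα.isContactPair_chart (mem_chart_source E p₀)
        (ha.differentiableAt (by simp))
    · exact ha.comp (t₀, ψ p₀ p₀) contDiffAt_snd
    · exact hdb.comp (t₀, ψ p₀ p₀) contDiffAt_snd
    · refine ContDiffAt.fderiv (n := ∞) (f := fun q : ℝ × E ↦ F q.1) (g := fun q ↦ q.2) ?_
        contDiffAt_snd (by simp)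
      have hφ : ContDiffAt ℝ ∞ (fun r : (ℝ × E) × E ↦ (r.1.1, r.2)) ((t₀, ψ p₀ p₀), ψ p₀ p₀) := by
        fun_prop
      exact ContDiffAt.comp (f := fun r : (ℝ × E) × E ↦ (r.1.1, r.2)) _ hFs hφ
    · exact hFs
  rw [← contMDiffAt_prod_iff_contDiffAt] at hG
  have h5 := hG.comp (t₀, p₀) (f := fun q : ℝ × C ↦ (q.1, ψ p₀ q.2))
    (contMDiffAt_fst.prodMk (contMDiffAt_extChartAt.comp (t₀, p₀) contMDiffAt_snd))
  refine h5.congr_of_eventuallyEq ?_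
  filter_upwards [hFd, hev, hsd] with q h1 h2 h3
  refine (hα.ham_in_chart (h := fun p ↦ f (q.1, p)) h2 h3 h1).trans ?_
  simp only [Function.comp_apply, hF]
  rw [(ψ p₀).left_inv (by rwa [extChartAt_source])]
  rfl

end HamiltonianField

theorem hamVec_zero_one {E : Type*} [NormedAddCommGroup E] [NormedSpace ℝ E]
    (a : E →L[ℝ] ℝ) (b : E →L[ℝ] E →L[ℝ] ℝ) : hamVec a b 0 1 = reebVec a b := by
  simp [hamVec, reebVec]

section HamiltonianFieldSpec

variable {E : Type*} [NormedAddCommGroup E] [NormedSpace ℝ E] [FiniteDimensional ℝ E]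
  {C : Type*} [TopologicalSpace C] [ChartedSpace E C] [IsManifold 𝓘(ℝ, E) ∞ C]
  {α : OneForm 𝓘(ℝ, E) C}

theorem OneForm.IsContactOn.isHamiltonianVector_ham (hα : α.IsContactOn univ) (h : C → ℝ) (p : C) :
    α.IsHamiltonianVector h p (α.ham h p) := by
  have hp := hα.isContactPair p
  obtain ⟨h1, h2⟩ := hp.hamVec_spec (mfderiv 𝓘(ℝ, E) 𝓘(ℝ, ℝ) h p) (h p)
  obtain ⟨h3, h4⟩ := hp.reebVec_spec
  refine ⟨h1, reebVec (E := E) (α p) (α.dForm p), ⟨h3, fun w ↦ ?_⟩, fun w ↦ ?_⟩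
  · exact (α.d_eq_dForm p _ w).trans (h4 w)
  · exact (α.d_eq_dForm p _ w).trans (h2 w)

theorem OneForm.IsContactOn.eq_ham (hα : α.IsContactOn univ) {h : C → ℝ} {p : C}
    {X : TangentSpace 𝓘(ℝ, E) p} (h1 : α p X = h p)
    (h2 : ∀ w, α p w = 0 → α.d p X w = -differential h p w) : X = α.ham h p :=
  (hα.isContactPair p).eq_hamVec h1 fun w hw ↦ (α.d_eq_dForm p X w).symm.trans (h2 w hw)

omit [FiniteDimensional ℝ E] [IsManifold 𝓘(ℝ, E) ∞ C] in
theorem differential_const_mul {h : C → ℝ} {p : C} (hh : MDifferentiableAt 𝓘(ℝ, E) 𝓘(ℝ, ℝ) h p)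
    (c : ℝ) (w : TangentSpace 𝓘(ℝ, E) p) :
    differential (I := 𝓘(ℝ, E)) (fun q ↦ c * h q) p w = c * differential h p w := by
  have := const_smul_mfderiv hh c
  exact congrArg (fun l : E →L[ℝ] ℝ ↦ l w) this

omit [FiniteDimensional ℝ E] [IsManifold 𝓘(ℝ, E) ∞ C] in
theorem OneForm.d_smul_left (α : OneForm 𝓘(ℝ, E) C) (p : C) (c : ℝ)
    (u v : TangentSpace 𝓘(ℝ, E) p) : α.d p (c • u) v = c * α.d p u v := by
  refine (α.d_eq_dForm p _ v).trans (Eq.trans ?_ (congrArg (c * ·) (α.d_eq_dForm p u v)).symm)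
  exact congrArg (fun l : E →L[ℝ] ℝ ↦ l v) ((α.dForm p).map_smul c (u : E))

/-- Both sides satisfy the same linear equations; `c = 0` is allowed, as happens where a time change
is stationary. -/
theorem OneForm.IsContactOn.ham_const_mul (hα : α.IsContactOn univ) {h : C → ℝ} {p : C}
    (hh : MDifferentiableAt 𝓘(ℝ, E) 𝓘(ℝ, ℝ) h p) (c : ℝ) :
    α.ham (fun q ↦ c * h q) p = c • α.ham h p := by
  obtain ⟨h1, R, -, h2⟩ := hα.isHamiltonianVector_ham h p
  refine (hα.eq_ham ?_ fun w hw ↦ ?_).symm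
  · rw [map_smul, h1, smul_eq_mul]
  · rw [α.d_smul_left, h2, hw, differential_const_mul hh]
    ring

/-- The Reeb vector field is bounded for every Riemannian metric on a compact manifold. -/
theorem OneForm.IsContactOn.exists_reeb_bound [CompactSpace C] (hα : α.IsContactOn univ)
    (m : Bundle.ContMDiffRiemannianMetric 𝓘(ℝ, E) ∞ E (fun p : C ↦ TangentSpace 𝓘(ℝ, E) p)) :
    ∃ K : ℝ, 0 ≤ K ∧ ∀ p, ∃ R, α.IsReebVector p R ∧ √(m.inner p R R) ≤ K := by
  -- The Reeb field is the Hamiltonian field of the constant 1, so its smoothness is already known.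
  have h1 : ContMDiff 𝓘(ℝ, E) (𝓘(ℝ, E)).tangent ∞
      (fun p : C ↦ (⟨p, α.ham (fun _ ↦ 1) p⟩ : TangentBundle 𝓘(ℝ, E) C)) :=
    (hα.contMDiff_ham (f := fun _ ↦ 1) contMDiff_const).comp
      (f := fun p : C ↦ ((0 : ℝ), p)) (contMDiff_const.prodMk contMDiff_id)
  have h2 := ContMDiff.clm_bundle_apply₂ (E₃ := Bundle.Trivial C ℝ) (F₃ := ℝ) (b := id)
    (ψ := m.inner) m.contMDiff h1 h1
  have h3 : Continuous fun p : C ↦ m.inner p (α.ham (fun _ ↦ 1) p) (α.ham (fun _ ↦ 1) p) := by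
    rw [continuous_iff_continuousAt]
    intro p
    have := (Bundle.contMDiffAt_totalSpace.1 (h2 p)).2.continuousAt
    exact this
  obtain ⟨K, hK⟩ := (isCompact_range h3.sqrt).bddAbove
  refine ⟨max K 0, le_max_right _ _, fun p ↦ ⟨α.ham (fun _ ↦ 1) p, ?_, ?_⟩⟩
  · have hp := hα.isContactPair p
    have h4 : α.ham (fun _ ↦ 1) p = reebVec (E := E) (α p) (α.dForm p) := by
      have h5 : mfderiv 𝓘(ℝ, E) 𝓘(ℝ, ℝ) (fun _ : C ↦ (1 : ℝ)) p = 0 := mfderiv_const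
      exact (congrArg (fun k ↦ hamVec (E := E) (α p) (α.dForm p) k 1) h5).trans
        (hamVec_zero_one _ _)
    rw [h4]
    exact ⟨hp.reebVec_spec.1, fun w ↦ (α.d_eq_dForm p _ w).trans (hp.reebVec_spec.2 w)⟩
  · exact (hK ⟨p, rfl⟩).trans (le_max_left _ _)

end HamiltonianFieldSpec

/-! ### Integral curves of time-dependent fields -/

section UniformTime

open scoped Topology

variable {E : Type*} [NormedAddCommGroup E] [NormedSpace ℝ E]
  {H : Type*} [TopologicalSpace H] {I : ModelWithCorners ℝ E H}
  {M : Type*} [TopologicalSpace M] [ChartedSpace H M] [IsManifold I 1 M]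

/-- Integral curves of a `C¹` vector field exist for a time that is locally uniform in the initial
point. -/
theorem exists_eventually_isMIntegralCurveOn [CompleteSpace E] [BoundarylessManifold I M]
    {v : (x : M) → TangentSpace I x} {x₀ : M}
    (hv : ContMDiffAt I I.tangent 1 (fun x ↦ (⟨x, v x⟩ : TangentBundle I M)) x₀) :
    ∃ ε > (0 : ℝ), ∀ᶠ x in 𝓝 x₀, ∃ γ : ℝ → M, γ 0 = x ∧ IsMIntegralCurveOn γ v (Ioo (-ε) ε) := by
  have hx : I.IsInteriorPoint x₀ := BoundarylessManifold.isInteriorPoint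
  rw [contMDiffAt_iff] at hv
  obtain ⟨_, hv⟩ := hv
  obtain ⟨ε, hε, a, r, L, K, hr, hpl⟩ := IsPicardLindelof.of_contDiffAt_one
    (hv.contDiffAt (range_mem_nhds_isInteriorPoint hx)).snd
  obtain ⟨f, hf1, hf2⟩ :=
    (hpl 0).exists_forall_mem_closedBall_eq_hasDerivWithinAt_continuousOn
  have hbox : Metric.closedBall (extChartAt I x₀ x₀) (r : ℝ) ×ˢ Icc (0 - ε) (0 + ε) ∈
      𝓝 (extChartAt I x₀ x₀, (0 : ℝ)) :=
    prod_mem_nhds (Metric.closedBall_mem_nhds _ hr) (Icc_mem_nhds (by linarith) (by linarith))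
  have hcont : ContinuousAt f (extChartAt I x₀ x₀, (0 : ℝ)) := hf2.continuousAt hbox
  have hval : f (extChartAt I x₀ x₀, (0 : ℝ)) = extChartAt I x₀ x₀ :=
    (hf1 _ (Metric.mem_closedBall_self r.2)).1
  -- Joint continuity of the local flow keeps it inside the chart for all nearby initial points and
  -- a common short time.
  have hnhds : ∀ᶠ y in 𝓝 (extChartAt I x₀ x₀, (0 : ℝ)),
      f y ∈ interior (extChartAt I x₀).target := by
    refine hcont.eventually ?_
    rw [hval]
    exact isOpen_interior.mem_nhds ((I.isInteriorPoint_iff).mp hx)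
  rw [nhds_prod_eq] at hnhds
  obtain ⟨pa, hpa, pb, hpb, hab⟩ := Filter.eventually_prod_iff.1 hnhds
  obtain ⟨ε', hε', hball⟩ := Metric.eventually_nhds_iff_ball.1 hpb
  refine ⟨min ε ε', lt_min hε hε', ?_⟩
  have hcx := continuousAt_extChartAt (I := I) x₀
  filter_upwards [hcx.eventually hpa, hcx.eventually (Metric.closedBall_mem_nhds _ hr),
    extChartAt_source_mem_nhds (I := I) x₀] with x hx1 hx2 hx3
  have hα := hf1 _ hx2
  set g : ℝ → E := fun t ↦ f (extChartAt I x₀ x, t) with hg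
  refine ⟨(extChartAt I x₀).symm ∘ g, ?_, fun t ht ↦ ?_⟩
  · change (extChartAt I x₀).symm (f (extChartAt I x₀ x, 0)) = x
    rw [hα.1, (extChartAt I x₀).left_inv hx3]
  have htε : t ∈ Ioo (0 - ε) (0 + ε) :=
    ⟨by linarith [ht.1, min_le_left ε ε'], by linarith [ht.2, min_le_left ε ε']⟩
  have hd := (hα.2 t (Ioo_subset_Icc_self htε)).hasDerivAt (Icc_mem_nhds htε.1 htε.2)
  have hf3 : f (extChartAt I x₀ x, t) ∈ interior (extChartAt I x₀).target := by
    refine hab hx1 (hball t ?_)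
    rw [Metric.mem_ball, Real.dist_eq, sub_zero, abs_lt]
    exact ⟨by linarith [ht.1, min_le_right ε ε'], by linarith [ht.2, min_le_right ε ε']⟩
  set xₜ : M := (extChartAt I x₀).symm (g t) with hxt
  have h : HasDerivAt g (x := t) <|
      fderivWithin ℝ (extChartAt I x₀ ∘ (extChartAt I xₜ).symm)
    (range I) (extChartAt I xₜ xₜ) (v xₜ) := hd
  rw [← tangentCoordChange_def] at h
  have hf3' := mem_of_mem_of_subset hf3 interior_subset
  have hft1 := mem_preimage.mp <|
    mem_of_mem_of_subset hf3' (extChartAt I x₀).target_subset_preimage_source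
  have hft2 := mem_extChartAt_source (I := I) xₜ
  apply HasMFDerivAt.hasMFDerivWithinAt
  have hc : ContinuousAt (extChartAt I x₀).symm (g t) := continuousAt_extChartAt_symm'' hf3'
  have hvx : tangentCoordChange I x₀ xₜ xₜ (tangentCoordChange I xₜ x₀ xₜ (v xₜ)) = v xₜ :=
    (tangentCoordChange_comp ⟨⟨hft2, hft1⟩, hft2⟩).trans (tangentCoordChange_self hft2)
  suffices key : HasDerivAt ((extChartAt I xₜ ∘ (extChartAt I x₀).symm) ∘ g)
      (tangentCoordChange I x₀ xₜ xₜ (tangentCoordChange I xₜ x₀ xₜ (v xₜ))) t by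
    rw [hvx] at key
    exact ⟨hc.comp h.continuousAt, key.hasFDerivAt.hasFDerivWithinAt (s := range 𝓘(ℝ, ℝ))⟩
  apply HasFDerivAt.comp_hasDerivAt _ _ h
  apply HasFDerivWithinAt.hasFDerivAt (s := range I) _ <|
    mem_nhds_iff.mpr ⟨interior (extChartAt I x₀).target,
      subset_trans interior_subset (extChartAt_target_subset_range ..),
      isOpen_interior, hf3⟩
  rw [← (extChartAt I x₀).right_inv hf3']
  exact hasFDerivWithinAt_tangentCoordChange ⟨hft1, hft2⟩

end UniformTime

section TimeDependent

open scoped Topology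

variable {E : Type*} [NormedAddCommGroup E] [NormedSpace ℝ E]
  {C : Type*} [TopologicalSpace C] [ChartedSpace E C]

/-- The autonomous vector field on `ℝ × C` of a time-dependent vector field on `C`. -/
def suspendField (X : ∀ (_ : ℝ) (p : C), TangentSpace 𝓘(ℝ, E) p) (q : ℝ × C) :
    TangentSpace (𝓘(ℝ, ℝ).prod 𝓘(ℝ, E)) q :=
  ((1 : ℝ), (X q.1 q.2 : E))

/-- `c` is a solution at the time `t` of the time-dependent vector field `X`. -/
def IsSolutionAt (X : ∀ (_ : ℝ) (p : C), TangentSpace 𝓘(ℝ, E) p) (c : ℝ → C) (t : ℝ) : Prop :=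
  HasMFDerivAt 𝓘(ℝ, ℝ) 𝓘(ℝ, E) c t ((1 : ℝ →L[ℝ] ℝ).smulRight (X t (c t)))

variable {X : ∀ (_ : ℝ) (p : C), TangentSpace 𝓘(ℝ, E) p}

theorem IsSolutionAt.suspend {c : ℝ → C} {t : ℝ} (h : IsSolutionAt X c t) :
    HasMFDerivAt 𝓘(ℝ, ℝ) (𝓘(ℝ, ℝ).prod 𝓘(ℝ, E)) (fun s ↦ (s, c s)) t
      ((1 : ℝ →L[ℝ] ℝ).smulRight (suspendField X (t, c t))) := by
  have h1 := (hasMFDerivAt_id (I := 𝓘(ℝ, ℝ)) t).prodMk h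
  refine h1.congr_mfderiv (ContinuousLinearMap.ext fun (s : ℝ) ↦ ?_)
  exact Prod.ext (mul_one s).symm rfl

variable [IsManifold 𝓘(ℝ, E) 1 C]

theorem contMDiff_suspend
    (hX : ContMDiff (𝓘(ℝ, ℝ).prod 𝓘(ℝ, E)) (𝓘(ℝ, E)).tangent 1
      (fun q : ℝ × C ↦ (⟨q.2, X q.1 q.2⟩ : TangentBundle 𝓘(ℝ, E) C))) :
    ContMDiff (𝓘(ℝ, ℝ).prod 𝓘(ℝ, E)) (𝓘(ℝ, ℝ).prod 𝓘(ℝ, E)).tangent 1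
      (fun q : ℝ × C ↦
        (⟨q, suspendField X q⟩ : TangentBundle (𝓘(ℝ, ℝ).prod 𝓘(ℝ, E)) (ℝ × C))) := by
  have h1 : ContMDiff 𝓘(ℝ, ℝ) (𝓘(ℝ, ℝ)).tangent 1
      (fun t : ℝ ↦ (⟨t, (1 : ℝ)⟩ : TangentBundle 𝓘(ℝ, ℝ) ℝ)) :=
    contMDiff_vectorSpace_iff_contDiff.2 contDiff_const
  have h2 := (h1.comp (contMDiff_fst (M := ℝ) (N := C) (I := 𝓘(ℝ, ℝ)) (J := 𝓘(ℝ, E)))).prodMk hX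
  exact contMDiff_equivTangentBundleProd_symm.comp h2

/-- Solutions of a smooth time-dependent vector field are unique. -/
theorem IsSolutionAt.eq [T2Space C]
    (hX : ContMDiff (𝓘(ℝ, ℝ).prod 𝓘(ℝ, E)) (𝓘(ℝ, E)).tangent 1
      (fun q : ℝ × C ↦ (⟨q.2, X q.1 q.2⟩ : TangentBundle 𝓘(ℝ, E) C)))
    [CompleteSpace E] {c c' : ℝ → C} (hc : ∀ t, IsSolutionAt X c t)
    (hc' : ∀ t, IsSolutionAt X c' t) {t₀ : ℝ} (h : c t₀ = c' t₀) : c = c' := by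
  have h1 : IsMIntegralCurve (fun s ↦ (s, c s)) (suspendField X) := fun t ↦ (hc t).suspend
  have h2 : IsMIntegralCurve (fun s ↦ (s, c' s)) (suspendField X) := fun t ↦ (hc' t).suspend
  have h3 := isMIntegralCurve_Ioo_eq_of_contMDiff_boundaryless (t₀ := t₀)
    (contMDiff_suspend hX) h1 h2 (by simp [h])
  ext t
  exact (Prod.ext_iff.1 (congrFun h3 t)).2

/-- A smooth time-periodic vector field on a compact manifold is complete. -/
theorem exists_isSolutionAt [T2Space C] [CompactSpace C] [CompleteSpace E]
    (hX : ContMDiff (𝓘(ℝ, ℝ).prod 𝓘(ℝ, E)) (𝓘(ℝ, E)).tangent 1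
      (fun q : ℝ × C ↦ (⟨q.2, X q.1 q.2⟩ : TangentBundle 𝓘(ℝ, E) C)))
    {P : ℝ} (hP : 0 < P) (hper : ∀ (n : ℤ) t p, X (t + n * P) p = X t p) (p : C) :
    ∃ c : ℝ → C, c 0 = p ∧ ∀ t, IsSolutionAt X c t := by
  have hv := contMDiff_suspend hX
  have hloc : ∃ ε > (0 : ℝ), ∀ x ∈ Icc 0 P ×ˢ (univ : Set C), ∃ γ : ℝ → ℝ × C, γ 0 = x ∧
      IsMIntegralCurveOn γ (suspendField X) (Ioo (-ε) ε) := by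
    refine (isCompact_Icc.prod isCompact_univ).induction_on
      (p := fun s ↦ ∃ ε > (0 : ℝ), ∀ x ∈ s, ∃ γ : ℝ → ℝ × C, γ 0 = x ∧
        IsMIntegralCurveOn γ (suspendField X) (Ioo (-ε) ε)) ⟨1, one_pos, by simp⟩ ?_ ?_ ?_
    · rintro s t hst ⟨ε, hε, h⟩
      exact ⟨ε, hε, fun x hx ↦ h x (hst hx)⟩
    · rintro s t ⟨ε, hε, h⟩ ⟨ε', hε', h'⟩
      refine ⟨min ε ε', lt_min hε hε', fun x hx ↦ ?_⟩
      rcases hx with hx | hx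
      · obtain ⟨γ, h1, h2⟩ := h x hx
        exact ⟨γ, h1, h2.mono (Ioo_subset_Ioo (neg_le_neg (min_le_left _ _)) (min_le_left _ _))⟩
      · obtain ⟨γ, h1, h2⟩ := h' x hx
        exact ⟨γ, h1, h2.mono (Ioo_subset_Ioo (neg_le_neg (min_le_right _ _)) (min_le_right _ _))⟩
    · intro x _
      obtain ⟨ε, hε, h⟩ := exists_eventually_isMIntegralCurveOn (hv x)
      exact ⟨_, mem_nhdsWithin_of_mem_nhds h, ε, hε, fun y hy ↦ hy⟩
  obtain ⟨ε, hε, hloc⟩ := hloc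
  -- Compactness gives a uniform existence time over one period. Any other starting time is moved
  -- there by subtracting whole periods, and a uniform time implies completeness.
  have hall : ∀ x : ℝ × C, ∃ γ : ℝ → ℝ × C, γ 0 = x ∧
      IsMIntegralCurveOn γ (suspendField X) (Ioo (-ε) ε) := by
    rintro ⟨t, p⟩
    obtain ⟨γ, h1, h2⟩ := hloc (t - ⌊t / P⌋ * P, p)
      ⟨⟨Int.sub_floor_div_mul_nonneg t hP, (Int.sub_floor_div_mul_lt t hP).le⟩, mem_univ _⟩
    set n : ℤ := ⌊t / P⌋ with hn
    refine ⟨fun s ↦ ((γ s).1 + n * P, (γ s).2), by simp [h1], fun s hs ↦ ?_⟩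
    have h3 : HasMFDerivAt (𝓘(ℝ, ℝ).prod 𝓘(ℝ, E)) (𝓘(ℝ, ℝ).prod 𝓘(ℝ, E))
        (fun q : ℝ × C ↦ (q.1 + n * P, q.2)) (γ s)
        (ContinuousLinearMap.id ℝ (ℝ × E)) := by
      have h4 : HasMFDerivAt 𝓘(ℝ, ℝ) 𝓘(ℝ, ℝ) (fun r : ℝ ↦ r + n * P) (γ s).1
          (ContinuousLinearMap.id ℝ ℝ) :=
        ((hasFDerivAt_id (γ s).1).add_const (n * P)).hasMFDerivAt
      exact (h4.comp (γ s) (hasMFDerivAt_fst (γ s))).prodMk (hasMFDerivAt_snd (γ s))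
    have h5 := h3.comp_hasMFDerivWithinAt s (h2 s hs)
    refine h5.congr_mfderiv (ContinuousLinearMap.ext fun (r : ℝ) ↦ ?_)
    refine Prod.ext rfl ?_
    exact congrArg (fun w : E ↦ r • w) (hper n (γ s).1 (γ s).2).symm
  obtain ⟨γ, hγ0, hγ⟩ := exists_isMIntegralCurve_of_isMIntegralCurveOn hv hε hall (0, p)
  -- The time component of the suspended field is 1, so the first coordinate of `γ` is the parameter
  -- itself.
  have h1 : ∀ t, HasDerivAt (fun s ↦ (γ s).1 - s) 0 t := fun t ↦ by
    have h2 := (hasMFDerivAt_fst (I := 𝓘(ℝ, ℝ)) (I' := 𝓘(ℝ, E)) (γ t)).comp t (hγ t)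
    have h3 : HasFDerivAt (fun s ↦ (γ s).1) (ContinuousLinearMap.id ℝ ℝ) t :=
      HasMFDerivAt.hasFDerivAt
        (h2.congr_mfderiv (ContinuousLinearMap.ext fun (r : ℝ) ↦ mul_one r))
    have h4 := h3.hasDerivAt.sub (hasDerivAt_id t)
    rw [ContinuousLinearMap.id_apply, sub_self] at h4
    exact h4
  have h2 : ∀ t, (γ t).1 = t := fun t ↦ by
    have := is_const_of_deriv_eq_zero (fun s ↦ (h1 s).differentiableAt) (fun s ↦ (h1 s).deriv) t 0
    simp only [hγ0] at this
    linarith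
  refine ⟨fun t ↦ (γ t).2, by simp [hγ0], fun t ↦ ?_⟩
  have h3 := (hasMFDerivAt_snd (I := 𝓘(ℝ, ℝ)) (I' := 𝓘(ℝ, E)) (γ t)).comp t (hγ t)
  have h4 : (Prod.snd ∘ γ) = fun t ↦ (γ t).2 := rfl
  rw [h4] at h3
  refine h3.congr_mfderiv (ContinuousLinearMap.ext fun (r : ℝ) ↦ ?_)
  exact congrArg (fun s : ℝ ↦ r • (X s (γ t).2 : E)) (h2 t)

end TimeDependent

/-! ### One-sided velocities at the ends of an interval -/

section ExtendDerivative

open scoped Topology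

variable {E : Type*} [NormedAddCommGroup E] [NormedSpace ℝ E]
  {C : Type*} [TopologicalSpace C] [ChartedSpace E C] [IsManifold 𝓘(ℝ, E) 1 C]

/-- A curve whose velocity on an open interval extends continuously to the closed interval has this
extension as its velocity on the closed interval. -/
theorem hasMFDerivWithinAt_Icc_of_continuousOn {c : ℝ → C} {W : ∀ t, TangentSpace 𝓘(ℝ, E) (c t)}
    {a b : ℝ} (hab : a < b)
    (hW : ContinuousOn (fun t ↦ (⟨c t, W t⟩ : TangentBundle 𝓘(ℝ, E) C)) (Icc a b))
    (hd : ∀ t ∈ Ioo a b,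
      HasMFDerivAt 𝓘(ℝ, ℝ) 𝓘(ℝ, E) c t ((1 : ℝ →L[ℝ] ℝ).smulRight (W t)))
    {t₀ : ℝ} (ht₀ : t₀ ∈ Icc a b) :
    HasMFDerivWithinAt 𝓘(ℝ, ℝ) 𝓘(ℝ, E) c (Icc a b) t₀ ((1 : ℝ →L[ℝ] ℝ).smulRight (W t₀)) := by
  set p₀ := c t₀ with hp₀
  have hcW := (FiberBundle.continuousWithinAt_totalSpace E _).1 (hW t₀ ht₀)
  have hc : ContinuousOn c (Icc a b) := fun t ht ↦
    ((FiberBundle.continuousWithinAt_totalSpace E _).1 (hW t ht)).1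
  set w : ℝ → E := fun t ↦ tangentCoordChange 𝓘(ℝ, E) (c t) p₀ (c t) (W t) with hw
  have hwc : ContinuousWithinAt w (Icc a b) t₀ := hcW.2
  have hw0 : w t₀ = W t₀ := tangentCoordChange_self (mem_extChartAt_source p₀)
  obtain ⟨U, hU, htU, hUs⟩ := mem_nhdsWithin.1 ((hc t₀ ht₀).preimage_mem_nhdsWithin
    ((chartAt E p₀).open_source.mem_nhds (mem_chart_source E p₀)))
  obtain ⟨η, hη, hball⟩ := Metric.isOpen_iff.1 hU t₀ htU
  rw [Real.ball_eq_Ioo] at hball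
  set l := max a (t₀ - η / 2) with hl
  -- On the window `[l, u]` around `t₀` the curve stays in one chart, where the vector-space theorem
  -- on limits of derivatives applies.
  set u := min b (t₀ + η / 2) with hu
  have hlu : l < u := max_lt (lt_min hab (by linarith [ht₀.1])) (lt_min (by linarith [ht₀.2])
    (by linarith))
  have hsub : Icc l u ⊆ Icc a b := Icc_subset_Icc (le_max_left _ _) (min_le_left _ _)
  have hsrc : ∀ t ∈ Icc l u, c t ∈ (chartAt E p₀).source := fun t ht ↦
    hUs ⟨hball ⟨by linarith [(le_max_right a (t₀ - η / 2)).trans ht.1],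
      by linarith [ht.2.trans (min_le_right b (t₀ + η / 2))]⟩, hsub ht⟩
  have hlin : ∀ (T : E →L[ℝ] E) (r : ℝ) (x : E), T (r • x) = r • T x := fun T r x ↦ map_smul T r x
  have hder : ∀ t ∈ Ioo l u, HasDerivAt (extChartAt 𝓘(ℝ, E) p₀ ∘ c) (w t) t := by
    intro t ht
    have hct := hsrc t (Ioo_subset_Icc_self ht)
    have h1 : HasMFDerivAt 𝓘(ℝ, E) 𝓘(ℝ, E) (extChartAt 𝓘(ℝ, E) p₀) (c t)
        (tangentCoordChange 𝓘(ℝ, E) (c t) p₀ (c t) : E →L[ℝ] E) := by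
      have h2 : mfderiv 𝓘(ℝ, E) 𝓘(ℝ, E) (extChartAt 𝓘(ℝ, E) p₀) (c t) =
          tangentCoordChange 𝓘(ℝ, E) (c t) p₀ (c t) := by
        rw [← TangentBundle.continuousLinearMapAt_trivializationAt hct,
          TangentBundle.continuousLinearMapAt_trivializationAt_eq_core hct]
      rw [← h2]
      exact (mdifferentiableAt_extChartAt hct).hasMFDerivAt
    have h3 := h1.comp t (hd t ⟨(le_max_left _ _).trans_lt ht.1, ht.2.trans_le (min_le_left _ _)⟩)
    have h4 : HasFDerivAt (extChartAt 𝓘(ℝ, E) p₀ ∘ c) ((1 : ℝ →L[ℝ] ℝ).smulRight (w t)) t :=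
      HasMFDerivAt.hasFDerivAt (E' := E) (h3.congr_mfderiv (ContinuousLinearMap.ext fun (r : ℝ) ↦
        hlin (tangentCoordChange 𝓘(ℝ, E) (c t) p₀ (c t)) r (W t)))
    simpa using h4.hasDerivAt
  have hclos : closure (Ioo l u) = Icc l u := closure_Ioo hlu.ne
  have hmain : HasFDerivWithinAt (extChartAt 𝓘(ℝ, E) p₀ ∘ c)
      ((1 : ℝ →L[ℝ] ℝ).smulRight (w t₀)) (closure (Ioo l u)) t₀ := by
    refine hasFDerivWithinAt_closure_of_tendsto_fderiv
      (fun t ht ↦ (hder t ht).differentiableAt.differentiableWithinAt) (convex_Ioo l u) isOpen_Ioo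
      (fun t ht ↦ ?_) ?_
    · rw [hclos] at ht
      exact ((continuousAt_extChartAt' (by rw [extChartAt_source]; exact hsrc t ht)).comp_continuousWithinAt
        ((hc t (hsub ht)).mono (Ioo_subset_Icc_self.trans hsub)))
    · have h1 : Filter.Tendsto w (𝓝[Ioo l u] t₀) (𝓝 (w t₀)) :=
        hwc.mono (Ioo_subset_Icc_self.trans hsub)
      have h2 : Continuous fun x : E ↦ (1 : ℝ →L[ℝ] ℝ).smulRight x := by fun_prop
      refine ((h2.tendsto (w t₀)).comp h1).congr' ?_
      filter_upwards [self_mem_nhdsWithin] with t ht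
      refine ContinuousLinearMap.ext fun r ↦ ?_
      rw [(hder t ht).hasFDerivAt.fderiv]
      rfl
  rw [hclos, hw0] at hmain
  have hnhds : Icc l u ∈ 𝓝[Icc a b] t₀ := by
    have h1 : Ioo (t₀ - η / 2) (t₀ + η / 2) ∈ 𝓝 t₀ := Ioo_mem_nhds (by linarith) (by linarith)
    filter_upwards [mem_nhdsWithin_of_mem_nhds h1, self_mem_nhdsWithin] with t ht1 ht2
    exact ⟨max_le ht2.1 ht1.1.le, le_min ht2.2 ht1.2.le⟩
  have hfin := hmain.mono_of_mem_nhdsWithin hnhds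
  exact ⟨hc t₀ ht₀, hfin.mono inter_subset_left⟩

end ExtendDerivative

/-! ### The flow of a time-dependent contact Hamiltonian -/

section Flow

variable {E : Type*} [NormedAddCommGroup E] [NormedSpace ℝ E] [FiniteDimensional ℝ E]
  {C : Type*} [TopologicalSpace C] [ChartedSpace E C] [IsManifold 𝓘(ℝ, E) ∞ C]
  {α : OneForm 𝓘(ℝ, E) C} {g : ℝ → C → ℝ}

omit [FiniteDimensional ℝ E] [IsManifold 𝓘(ℝ, E) ∞ C] in
-- A time change with values in `[0, 1]` turns a function smooth up to the boundary of `[0, 1] × C`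
-- into one smooth on `ℝ × C`, without extending `g`.
theorem contMDiff_reparam
    (hg : ContMDiffOn (𝓘(ℝ, ℝ).prod 𝓘(ℝ, E)) 𝓘(ℝ, ℝ) ∞ (fun q : ℝ × C ↦ g q.1 q.2)
      (Icc 0 1 ×ˢ univ)) {κ : ℝ → ℝ} (hκ : ContDiff ℝ ∞ κ) (hκ01 : ∀ s, κ s ∈ Icc (0 : ℝ) 1) :
    ContMDiff (𝓘(ℝ, ℝ).prod 𝓘(ℝ, E)) 𝓘(ℝ, ℝ) ∞ (fun q : ℝ × C ↦ g (κ q.1) q.2) :=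
  hg.comp_contMDiff (f := fun q : ℝ × C ↦ (κ q.1, q.2))
    ((hκ.contMDiff.comp contMDiff_fst).prodMk contMDiff_snd) fun q ↦ ⟨hκ01 q.1, mem_univ _⟩

omit [FiniteDimensional ℝ E] [IsManifold 𝓘(ℝ, E) ∞ C] in
theorem mdifferentiableAt_slice {f : ℝ × C → ℝ}
    (hf : ContMDiff (𝓘(ℝ, ℝ).prod 𝓘(ℝ, E)) 𝓘(ℝ, ℝ) ∞ f) (s : ℝ) (p : C) :
    MDifferentiableAt 𝓘(ℝ, E) 𝓘(ℝ, ℝ) (fun q ↦ f (s, q)) p :=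
  ((hf.comp (f := fun q : C ↦ (s, q)) (contMDiff_const.prodMk contMDiff_id)) p).mdifferentiableAt
    (by simp)

/-- The time-dependent vector field `κ'(s) X_{κ(s)}`, with `X_t` the Hamiltonian vector field of
`g t`. -/
noncomputable def reparamField (α : OneForm 𝓘(ℝ, E) C) (g : ℝ → C → ℝ) (κ : ℝ → ℝ) (s : ℝ) (p : C) :
    TangentSpace 𝓘(ℝ, E) p :=
  deriv κ s • α.ham (g (κ s)) p

theorem OneForm.IsContactOn.contMDiff_reparamField (hα : α.IsContactOn univ)
    (hg : ContMDiffOn (𝓘(ℝ, ℝ).prod 𝓘(ℝ, E)) 𝓘(ℝ, ℝ) ∞ (fun q : ℝ × C ↦ g q.1 q.2)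
      (Icc 0 1 ×ˢ univ)) {κ : ℝ → ℝ} (hκ : ContDiff ℝ ∞ κ) (hκ01 : ∀ s, κ s ∈ Icc (0 : ℝ) 1) :
    ContMDiff (𝓘(ℝ, ℝ).prod 𝓘(ℝ, E)) (𝓘(ℝ, E)).tangent 1
      (fun q : ℝ × C ↦ (⟨q.2, reparamField α g κ q.1 q.2⟩ : TangentBundle 𝓘(ℝ, E) C)) := by
  have h1 := contMDiff_reparam hg hκ hκ01
  have hκ' : ContDiff ℝ ∞ (deriv κ) := (contDiff_infty_iff_deriv.1 hκ).2
  have h2 : ContMDiff (𝓘(ℝ, ℝ).prod 𝓘(ℝ, E)) 𝓘(ℝ, ℝ) ∞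
      (fun q : ℝ × C ↦ deriv κ q.1 * g (κ q.1) q.2) :=
    (hκ'.contMDiff.comp contMDiff_fst).mul h1
  have h3 := (hα.contMDiff_ham h2).of_le (n := ∞) (m := 1) (WithTop.coe_le_coe.2 le_top)
  convert! h3 using 3 with q
  exact (hα.ham_const_mul (mdifferentiableAt_slice h1 q.1 q.2) _).symm

/-- Existence of the flow of a time-dependent contact Hamiltonian on a closed manifold. -/
theorem OneForm.IsContactOn.exists_hamiltonianFlow [T2Space C] [CompactSpace C]
    (hα : α.IsContactOn univ)
    (hg : ContMDiffOn (𝓘(ℝ, ℝ).prod 𝓘(ℝ, E)) 𝓘(ℝ, ℝ) ∞ (fun q : ℝ × C ↦ g q.1 q.2)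
      (Icc 0 1 ×ˢ univ)) :
    ∃ φ : ℝ → C → C, (∀ p, φ 0 p = p) ∧ ∀ p, ∀ t ∈ Icc (0 : ℝ) 1,
      HasVelocity (I := 𝓘(ℝ, E)) (fun s ↦ φ s p) 0 1 t (α.ham (g t) (φ t p)) := by
  have : CompleteSpace E := FiniteDimensional.complete ℝ E
  -- This time change is smooth, periodic and has range `[0, 1]`, so the field `κ'(s) X_{κ(s)}` is
  -- complete. The inverse change `u` below recovers the original time.
  set κ : ℝ → ℝ := fun s ↦ (1 - Real.cos s) / 2 with hκdef
  have hκ : ContDiff ℝ ∞ κ := (contDiff_const.sub Real.contDiff_cos).div_const 2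
  have hκ01 : ∀ s, κ s ∈ Icc (0 : ℝ) 1 := fun s ↦
    ⟨by simp only [hκdef]; linarith [Real.cos_le_one s],
      by simp only [hκdef]; linarith [Real.neg_one_le_cos s]⟩
  have hκd : ∀ s, deriv κ s = Real.sin s / 2 := fun s ↦ by
    have := (((Real.hasDerivAt_cos s).const_sub 1).div_const 2).deriv
    rw [neg_neg] at this
    exact this
  have hX := hα.contMDiff_reparamField hg hκ hκ01
  have hper : ∀ (n : ℤ) t p,
      reparamField α g κ (t + n * (2 * Real.pi)) p = reparamField α g κ t p := fun n t p ↦ by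
    have h1 : κ (t + n * (2 * Real.pi)) = κ t := by
      simp only [hκdef, Real.cos_add_int_mul_two_pi]
    rw [reparamField, reparamField, hκd, hκd, h1, Real.sin_add_int_mul_two_pi]
  choose c hc0 hc using exists_isSolutionAt hX Real.two_pi_pos hper
  set u : ℝ → ℝ := fun t ↦ Real.arccos (1 - 2 * t) with hu
  have huc : Continuous u := Real.continuous_arccos.comp (by fun_prop)
  have hκu : ∀ t ∈ Icc (0 : ℝ) 1, κ (u t) = t := fun t ht ↦ by
    simp only [hκdef, hu]
    rw [Real.cos_arccos (by linarith [ht.2]) (by linarith [ht.1])]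
    ring
  refine ⟨fun t p ↦ c p (u t), fun p ↦ ?_, fun p t ht ↦ ?_⟩
  · simp only [hu]
    norm_num
    exact hc0 p
  · have hW : ContinuousOn (fun t ↦ (⟨c p (u t), α.ham (g t) (c p (u t))⟩ :
        TangentBundle 𝓘(ℝ, E) C)) (Icc 0 1) := by
      have h1 := (hα.contMDiff_ham (contMDiff_reparam hg hκ hκ01)).continuous
      have h2 : Continuous fun t ↦ (u t, c p (u t)) :=
        huc.prodMk ((continuous_iff_continuousAt.2 fun s ↦ (hc p s).continuousAt).comp huc)
      refine (h1.comp h2).continuousOn.congr fun s hs ↦ ?_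
      simp only [Function.comp_apply]
      rw [hκu s hs]
    refine hasMFDerivWithinAt_Icc_of_continuousOn (W := fun t ↦ α.ham (g t) (c p (u t)))
      zero_lt_one hW (fun s hs ↦ ?_) ht
    -- Only interior times are treated here: `arccos` is not differentiable at `±1`. The end points
    -- follow from continuity of the velocity.
    have hpos : 0 < 1 - (1 - 2 * s) ^ 2 := by nlinarith [hs.1, hs.2]
    have h1 : HasDerivAt u (2 / √(1 - (1 - 2 * s) ^ 2)) s := by
      have h2 := (Real.hasDerivAt_arccos (x := 1 - 2 * s) (by linarith [hs.2])
        (by linarith [hs.1])).comp s (((hasDerivAt_id s).const_mul 2).const_sub 1)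
      convert! h2 using 1
      ring
    have h3 := (hc p (u s)).comp s h1.hasFDerivAt.hasMFDerivAt
    refine h3.congr_mfderiv (ContinuousLinearMap.ext fun (r : ℝ) ↦ ?_)
    have h4 : deriv κ (u s) * (2 / √(1 - (1 - 2 * s) ^ 2)) = 1 := by
      have : √(1 - (1 - 2 * s) ^ 2) ≠ 0 := (Real.sqrt_pos.2 hpos).ne'
      rw [hκd, hu, Real.sin_arccos]
      field_simp
    have h5 : κ (u s) = s := hκu s (Ioo_subset_Icc_self hs)
    change (r * (2 / √(1 - (1 - 2 * s) ^ 2))) •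
      (deriv κ (u s) • (α.ham (g (κ (u s))) (c p (u s)) : E)) = r • (α.ham (g s) (c p (u s)) : E)
    rw [smul_smul, mul_assoc, mul_comm _ (deriv κ (u s)), h4, mul_one, h5]

end Flow

theorem OneForm.d_eq_fderiv {E : Type*} [NormedAddCommGroup E] [NormedSpace ℝ E]
    {H : Type*} [TopologicalSpace H] {I : ModelWithCorners ℝ E H} [I.Boundaryless]
    {M : Type*} [TopologicalSpace M] [ChartedSpace H M] (α : OneForm I M) (p : M)
    (u v : TangentSpace I p) :
    α.d p u v = (fderiv ℝ (α.inChart p) (extChartAt I p p) u) v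
      - (fderiv ℝ (α.inChart p) (extChartAt I p p) v) u := by
  simp only [OneForm.d, I.range_eq_univ, fderivWithin_univ]

/-! ### The form `α₀ + r² dθ - h dx` and its exterior derivative -/

section PerturbedForm

variable {E : Type*} [NormedAddCommGroup E] [NormedSpace ℝ E]
  {C : Type*} [TopologicalSpace C] [ChartedSpace E C]

local notation "ψ" => extChartAt 𝓘(ℝ, E)
local notation "IP" => ModelWithCorners.prod 𝓘(ℝ, E) 𝓘(ℝ, Plane)

/-- The first coordinate of the plane, as a linear form. -/
noncomputable abbrev dxForm : Plane →L[ℝ] ℝ := EuclideanSpace.proj 0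

theorem rSqDTheta_apply (x v : Plane) : rSqDTheta x v = x 0 * v 1 - x 1 * v 0 := rfl

/-- The form `α₀ + r² dθ - h dx`. -/
noncomputable def perturbedForm (α₀ : OneForm 𝓘(ℝ, E) C) (h : C × Plane → ℝ) :
    OneForm IP (C × Plane) :=
  fun q ↦ ((α₀ q.1 : E →L[ℝ] ℝ).comp (ContinuousLinearMap.fst ℝ E Plane)
    + (rSqDTheta q.2 - h q • dxForm).comp (ContinuousLinearMap.snd ℝ E Plane) :
      E × Plane →L[ℝ] ℝ)

/-- The form `a + r² dθ - h dx` on a vector space. -/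
noncomputable def modelForm (a : E → E →L[ℝ] ℝ) (h : E × Plane → ℝ) (y : E × Plane) :
    E × Plane →L[ℝ] ℝ :=
  (a y.1).comp (ContinuousLinearMap.fst ℝ E Plane)
    + (rSqDTheta y.2 - h y • dxForm).comp (ContinuousLinearMap.snd ℝ E Plane)

theorem perturbedForm_apply (α₀ : OneForm 𝓘(ℝ, E) C) (h : C × Plane → ℝ) (q : C × Plane)
    (U : E) (a : Plane) :
    (perturbedForm α₀ h q : E × Plane →L[ℝ] ℝ) (U, a) =
      α₀ q.1 U + (rSqDTheta q.2 a - h q * a 0) := rfl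

theorem perturbedForm_zero (α₀ : OneForm 𝓘(ℝ, E) C) {h : C × Plane → ℝ} {q : C × Plane}
    (hq : h q = 0) : perturbedForm α₀ h q = stdProductForm α₀ q := by
  simp only [perturbedForm, stdProductForm, hq, zero_smul, sub_zero]
  rfl

theorem perturbedForm_inChart [IsManifold 𝓘(ℝ, E) 1 C] (α₀ : OneForm 𝓘(ℝ, E) C)
    (h : C × Plane → ℝ) (q₀ : C × Plane) {y : E × Plane} (hy : y.1 ∈ (ψ q₀.1).target) :
    (perturbedForm α₀ h).inChart q₀ y =
      modelForm (α₀.inChart q₀.1) (fun y ↦ h ((ψ q₀.1).symm y.1, y.2)) y := by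
  have hext : ((extChartAt IP q₀).symm : E × Plane → C × Plane) =
      fun y ↦ ((ψ q₀.1).symm y.1, y.2) := by
    rw [extChartAt_prod]
    rfl
  have h1 : HasMFDerivAt 𝓘(ℝ, E) 𝓘(ℝ, E) (ψ q₀.1).symm y.1
      (mfderivWithin 𝓘(ℝ, E) 𝓘(ℝ, E) (ψ q₀.1).symm (range 𝓘(ℝ, E)) y.1) := by
    rw [modelWithCornersSelf_coe, range_id, mfderivWithin_univ]
    refine MDifferentiableAt.hasMFDerivAt ?_
    exact ((contMDiffOn_extChartAt_symm (n := 1) q₀.1).contMDiffAt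
      ((isOpen_extChartAt_target q₀.1).mem_nhds hy)).mdifferentiableAt (by simp)
  have h2 : HasMFDerivAt 𝓘(ℝ, E × Plane) 𝓘(ℝ, E) (fun y : E × Plane ↦ y.1) y
      (ContinuousLinearMap.fst ℝ E Plane) := hasFDerivAt_fst.hasMFDerivAt
  have h3 : HasMFDerivAt 𝓘(ℝ, E × Plane) 𝓘(ℝ, Plane) (fun y : E × Plane ↦ y.2) y
      (ContinuousLinearMap.snd ℝ E Plane) := hasFDerivAt_snd.hasMFDerivAt
  have h4 := ((h1.comp y h2).prodMk h3).mfderiv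
  have hr : range IP = univ := ModelWithCorners.range_eq_univ _
  refine ContinuousLinearMap.ext fun v ↦ ?_
  rw [OneForm.inChart, hr, mfderivWithin_univ, hext]
  have h5 : mfderiv 𝓘(ℝ, E × Plane) IP (fun y : E × Plane ↦ ((ψ q₀.1).symm y.1, y.2)) y v =
    ((mfderivWithin 𝓘(ℝ, E) 𝓘(ℝ, E) (ψ q₀.1).symm (range 𝓘(ℝ, E)) y.1 v.1 : E), v.2) :=
    congrArg (fun l : E × Plane →L[ℝ] E × Plane ↦ l v) h4
  exact congrArg (fun w : E × Plane ↦
    (perturbedForm α₀ h ((ψ q₀.1).symm y.1, y.2) : E × Plane →L[ℝ] ℝ) w) h5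

theorem contDiff_rSqDTheta : ContDiff ℝ ∞ rSqDTheta := by
  have h0 : ContDiff ℝ ∞ (fun x : Plane ↦ x 0) := (EuclideanSpace.proj 0 : Plane →L[ℝ] ℝ).contDiff
  have h1 : ContDiff ℝ ∞ (fun x : Plane ↦ x 1) := (EuclideanSpace.proj 1 : Plane →L[ℝ] ℝ).contDiff
  exact (h0.smul contDiff_const).sub (h1.smul contDiff_const)

theorem contDiffAt_modelForm {P : Type*} [NormedAddCommGroup P] [NormedSpace ℝ P] {n : ℕ∞}
    {a : P → E →L[ℝ] ℝ} {h : P → ℝ} {z : P → Plane} {x : P}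
    (ha : ContDiffAt ℝ n a x) (hh : ContDiffAt ℝ n h x) (hz : ContDiffAt ℝ n z x) :
    ContDiffAt ℝ n (fun y ↦ (a y).comp (ContinuousLinearMap.fst ℝ E Plane)
      + (rSqDTheta (z y) - h y • dxForm).comp (ContinuousLinearMap.snd ℝ E Plane)) x := by
  have h1 : ContDiffAt ℝ n (fun y ↦ rSqDTheta (z y)) x :=
    (contDiff_rSqDTheta.of_le (WithTop.coe_le_coe.2 le_top)).contDiffAt.comp x hz
  exact (ha.clm_comp contDiffAt_const).add
    ((h1.sub (hh.smul contDiffAt_const)).clm_comp contDiffAt_const)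

theorem differentiableAt_modelForm {a : E → E →L[ℝ] ℝ} {h : E × Plane → ℝ} {y : E × Plane}
    (ha : DifferentiableAt ℝ a y.1) (hh : DifferentiableAt ℝ h y) :
    DifferentiableAt ℝ (modelForm a h) y := by
  have h1 : DifferentiableAt ℝ (fun y : E × Plane ↦ rSqDTheta y.2) y :=
    ((contDiff_rSqDTheta.differentiable (by simp)) y.2).comp y differentiableAt_snd
  have h2 : DifferentiableAt ℝ (fun y : E × Plane ↦ a y.1) y := ha.comp y differentiableAt_fst
  exact (h2.clm_comp (differentiableAt_const _)).add
    ((h1.sub (hh.smul (differentiableAt_const _))).clm_comp (differentiableAt_const _))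

theorem fderiv_modelForm {a : E → E →L[ℝ] ℝ} {h : E × Plane → ℝ} {y : E × Plane}
    (ha : DifferentiableAt ℝ a y.1) (hh : DifferentiableAt ℝ h y) (u v : E × Plane) :
    fderiv ℝ (modelForm a h) y u v =
      fderiv ℝ a y.1 u.1 v.1 + (rSqDTheta u.2 v.2 - fderiv ℝ h y u * v.2 0) := by
  -- With `v` held fixed, differentiating the form reduces to differentiating a scalar function.
  have h1 := ((differentiableAt_modelForm ha hh).hasFDerivAt.clm_apply
    (hasFDerivAt_const v y)).fderiv
  have h2 := congrArg (fun l : E × Plane →L[ℝ] ℝ ↦ l u) h1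
  have h3 : HasFDerivAt (fun y : E × Plane ↦ a y.1 v.1)
      (((fderiv ℝ a y.1).flip v.1).comp (ContinuousLinearMap.fst ℝ E Plane)) y := by
    have h4 := ha.hasFDerivAt.clm_apply (hasFDerivAt_const v.1 y.1)
    rw [ContinuousLinearMap.comp_zero, zero_add] at h4
    exact h4.comp y hasFDerivAt_fst
  have hlin : ∀ i, HasFDerivAt (fun y : E × Plane ↦ y.2 i)
      ((EuclideanSpace.proj i : Plane →L[ℝ] ℝ).comp (ContinuousLinearMap.snd ℝ E Plane)) y :=
    fun i ↦ ((EuclideanSpace.proj i : Plane →L[ℝ] ℝ).comp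
      (ContinuousLinearMap.snd ℝ E Plane)).hasFDerivAt
  have h5 := h3.add ((((hlin 0).mul_const (v.2 1)).sub ((hlin 1).mul_const (v.2 0))).sub
    (hh.hasFDerivAt.mul_const (v.2 0)))
  have h6 := congrArg (fun l : E × Plane →L[ℝ] ℝ ↦ l u) h5.fderiv
  have h7 : fderiv ℝ (modelForm a h) y u v =
      fderiv ℝ (fun y ↦ modelForm a h y v) y u := by
    rw [h2]
    simp
  rw [h7]
  refine h6.trans ?_
  simp [rSqDTheta_apply]
  ring

/-- This is `dα₀ + 2 dx∧dy - dh∧dx`, with `dh` split into its parts along `C` and along the plane.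
-/
theorem perturbedForm_d [IsManifold 𝓘(ℝ, E) ∞ C] {α₀ : OneForm 𝓘(ℝ, E) C}
    (hα₀ : α₀.SmoothOn univ) {h : C × Plane → ℝ} (hh : ContMDiff IP 𝓘(ℝ, ℝ) ∞ h)
    (p : C) (z : Plane) (U W : E) (a b : Plane) :
    (perturbedForm α₀ h).d (p, z) (U, a) (W, b) =
      α₀.d p U W + 2 * (a 0 * b 1 - a 1 * b 0)
        - ((differential (I := 𝓘(ℝ, E)) (fun p' ↦ h (p', z)) p U
              + fderiv ℝ (fun z' ↦ h (p, z')) z a) * b 0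
          - (differential (I := 𝓘(ℝ, E)) (fun p' ↦ h (p', z)) p W
              + fderiv ℝ (fun z' ↦ h (p, z')) z b) * a 0) := by
  set h' : E × Plane → ℝ := fun y ↦ h ((ψ p).symm y.1, y.2) with hh'
  have hda : DifferentiableAt ℝ (α₀.inChart p) (ψ p p) :=
    (hα₀.contDiffAt_inChart p).differentiableAt (by simp)
  have hdh : DifferentiableAt ℝ h' (ψ p p, z) := by
    have h1 : ContMDiffAt 𝓘(ℝ, E) 𝓘(ℝ, E) ∞ (ψ p).symm (ψ p p) :=
      (contMDiffOn_extChartAt_symm p).contMDiffAt (extChartAt_target_mem_nhds p)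
    have h2 : ContMDiffAt IP IP ∞ (fun y : E × Plane ↦ ((ψ p).symm y.1, y.2)) (ψ p p, z) :=
      (h1.comp (ψ p p, z) contMDiffAt_fst).prodMk contMDiffAt_snd
    exact (contMDiffAt_prod_iff_contDiffAt.1 (hh.contMDiffAt.comp (ψ p p, z) h2)).differentiableAt
      (by simp)
  have hpt : extChartAt IP (p, z) (p, z) = (ψ p p, z) := by
    rw [extChartAt_prod]; rfl
  have hev : (perturbedForm α₀ h).inChart (p, z) =ᶠ[nhds (ψ p p, z)]
      modelForm (α₀.inChart p) h' := by
    have : ∀ᶠ y : E × Plane in nhds (ψ p p, z), y.1 ∈ (ψ p).target :=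
      continuousAt_fst.eventually (extChartAt_target_mem_nhds (I := 𝓘(ℝ, E)) p)
    filter_upwards [this] with y hy using perturbedForm_inChart α₀ h (p, z) hy
  have hC : ∀ V : E, differential (I := 𝓘(ℝ, E)) (fun p' ↦ h (p', z)) p V =
      fderiv ℝ h' (ψ p p, z) (V, 0) := fun V ↦ by
    have h1 : HasFDerivAt (fun y : E ↦ h' (y, z))
        ((fderiv ℝ h' (ψ p p, z)).comp (ContinuousLinearMap.inl ℝ E Plane)) (ψ p p) :=
      HasFDerivAt.comp (f := fun y : E ↦ (y, z)) (ψ p p) hdh.hasFDerivAt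
        (hasFDerivAt_prodMk_left (ψ p p) z)
    have h2 := mfderiv_eq_fderiv_chart (h := fun p' ↦ h (p', z)) (mem_chart_source E p)
      h1.differentiableAt V
    rw [tangentCoordChange_self (mem_extChartAt_source p)] at h2
    refine h2.trans ?_
    exact congrArg (fun l : E →L[ℝ] ℝ ↦ l V) h1.fderiv
  have hP : ∀ c : Plane, fderiv ℝ (fun z' ↦ h (p, z')) z c =
      fderiv ℝ h' (ψ p p, z) (0, c) := fun c ↦ by
    have h1 : HasFDerivAt (fun z' : Plane ↦ h' (ψ p p, z'))
        ((fderiv ℝ h' (ψ p p, z)).comp (ContinuousLinearMap.inr ℝ E Plane)) z :=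
      HasFDerivAt.comp (f := fun z' : Plane ↦ (ψ p p, z')) z hdh.hasFDerivAt
        (hasFDerivAt_prodMk_right (ψ p p) z)
    have h2 : (fun z' : Plane ↦ h' (ψ p p, z')) = fun z' ↦ h (p, z') := by
      funext z'
      simp only [hh', extChartAt_to_inv]
    rw [← h2, h1.fderiv]
    rfl
  have hsum : ∀ (V : E) (c : Plane), fderiv ℝ h' (ψ p p, z) (V, c) =
      differential (I := 𝓘(ℝ, E)) (fun p' ↦ h (p', z)) p V
        + fderiv ℝ (fun z' ↦ h (p, z')) z c := fun V c ↦ by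
    rw [hC, hP, ← map_add, Prod.mk_add_mk, add_zero, zero_add]
  have hd : (perturbedForm α₀ h).d (p, z) (U, a) (W, b) =
      fderiv ℝ (modelForm (α₀.inChart p) h') (ψ p p, z) (U, a) (W, b)
        - fderiv ℝ (modelForm (α₀.inChart p) h') (ψ p p, z) (W, b) (U, a) := by
    refine ((perturbedForm α₀ h).d_eq_fderiv (p, z) _ _).trans ?_
    rw [hpt, hev.fderiv_eq]
  rw [hd, fderiv_modelForm hda hdh, fderiv_modelForm hda hdh, α₀.d_eq_extDerivForm_self,
    extDerivForm_apply, hsum, hsum, rSqDTheta_apply, rSqDTheta_apply]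
  ring

end PerturbedForm

/-! ### Contact condition, fibration and horizontal vectors -/

section PerturbedContact

/-- The nondegeneracy of `d(α₀ + r² dθ - h dx)` on the kernel of the form, at a point where `h`
has the value `c` and the partial differentials `k` and `l`. -/
theorem IsContactPair.perturbed_nondegenerate {E : Type*} [NormedAddCommGroup E] [NormedSpace ℝ E]
    {a : E →L[ℝ] ℝ} {b : E →L[ℝ] E →L[ℝ] ℝ} (hp : IsContactPair a b) {R : E} (hR : a R = 1)
    (hbR : ∀ w, b R w = 0) (k : E →L[ℝ] ℝ) (l : Plane →L[ℝ] ℝ) (z : Plane) (c : ℝ)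
    (hne : 2 + l !₂[0, 1] - z 0 * k R ≠ 0) {U : E} {ξ : Plane}
    (h0 : a U + (rSqDTheta z ξ - c * ξ 0) = 0)
    (h : ∀ (W : E) (η : Plane), a W + (rSqDTheta z η - c * η 0) = 0 →
      b U W + 2 * (ξ 0 * η 1 - ξ 1 * η 0)
        - ((k U + l ξ) * η 0 - (k W + l η) * ξ 0) = 0) : U = 0 ∧ ξ = 0 := by
  simp only [rSqDTheta_apply] at h0 h
  have hUR : ∀ r : ℝ, b U (r • R) = 0 := fun r ↦ by rw [hp.skew, map_smul, smul_apply, hbR]; simp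
  -- The multiple of `R` puts the lift of `∂_y` in the kernel of the form. As `R` is `b`-orthogonal
  -- to everything, the equation becomes `ξ 0` times the nonzero factor in `hne`.
  have h1 := h ((-z 0) • R) !₂[0, 1] (by simp [hR])
  rw [hUR] at h1
  simp only [map_smul, smul_eq_mul] at h1
  norm_num at h1
  have hξ0 : ξ 0 = 0 := by
    have : ξ 0 * (2 + l !₂[0, 1] - z 0 * k R) = 0 := by linarith
    exact (mul_eq_zero.1 this).resolve_right hne
  have hlξ : l ξ = ξ 1 * l !₂[0, 1] := by
    have : ξ = ξ 1 • !₂[(0 : ℝ), 1] := by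
      ext i
      fin_cases i <;> simp [hξ0]
    conv_lhs => rw [this]
    rw [map_smul, smul_eq_mul]
  -- Once `ξ 0 = 0`, testing with `(W, 0)` for `W ∈ ker a` shows that `U` has no component in `ker
  -- a`.
  have hU : U = a U • R := by
    rw [← sub_eq_zero]
    refine hp.nondegenerate _ (by simp [hR]) fun W hW ↦ ?_
    have h2 := h W 0 (by simp [hW])
    simp only [hξ0, PiLp.zero_apply] at h2
    rw [map_sub, sub_apply, map_smul, smul_apply, hbR]
    simpa using h2
  have hkU : k U = a U * k R := by
    conv_lhs => rw [hU]
    rw [map_smul, smul_eq_mul]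
  -- The lift of `∂_x` to the kernel. With `a U = -(z 0 * ξ 1)`, it gives `ξ 1` times the same
  -- nonzero factor.
  have h3 := h ((z 1 + c) • R) !₂[1, 0] (by simp [hR])
  rw [hUR, hlξ, hkU, hξ0] at h3
  norm_num at h3
  rw [hξ0] at h0
  have hξ1 : ξ 1 = 0 := by
    have haU : a U = -(z 0 * ξ 1) := by linarith
    rw [haU] at h3
    have : ξ 1 * (2 + l !₂[0, 1] - z 0 * k R) = 0 := by linarith
    exact (mul_eq_zero.1 this).resolve_right hne
  have haU : a U = 0 := by
    rw [hξ1] at h0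
    linarith
  refine ⟨by rw [hU, haU, zero_smul], ?_⟩
  ext i
  fin_cases i
  · exact hξ0
  · exact hξ1

variable {E : Type*} [NormedAddCommGroup E] [NormedSpace ℝ E]
  {C : Type*} [TopologicalSpace C] [ChartedSpace E C] [IsManifold 𝓘(ℝ, E) ∞ C]
  {α₀ : OneForm 𝓘(ℝ, E) C} {h : C × Plane → ℝ}

local notation "ψ" => extChartAt 𝓘(ℝ, E)
local notation "IP" => ModelWithCorners.prod 𝓘(ℝ, E) 𝓘(ℝ, Plane)

theorem contMDiffAt_inChart_perturbedForm (hα₀ : α₀.SmoothOn univ) (hh : ContMDiff IP 𝓘(ℝ, ℝ) ∞ h)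
    (x₀ : ℝ × (C × Plane)) :
    ContMDiffAt (𝓘(ℝ, ℝ).prod IP) 𝓘(ℝ, E × Plane →L[ℝ] ℝ) ∞
      (fun x : ℝ × (C × Plane) ↦
        (α₀.inChart x₀.2.1 (ψ x₀.2.1 x.2.1)).comp (ContinuousLinearMap.fst ℝ E Plane)
          + (rSqDTheta x.2.2 - (x.1 * h x.2) • dxForm).comp (ContinuousLinearMap.snd ℝ E Plane))
      x₀ := by
  have h1 : ContMDiffAt (𝓘(ℝ, ℝ).prod IP) 𝓘(ℝ, E →L[ℝ] ℝ) ∞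
      (fun x : ℝ × (C × Plane) ↦ α₀.inChart x₀.2.1 (ψ x₀.2.1 x.2.1)) x₀ := by
    have h2 : ContMDiffAt (𝓘(ℝ, ℝ).prod IP) 𝓘(ℝ, E) ∞
        (fun x : ℝ × (C × Plane) ↦ x.2.1) x₀ :=
      contMDiffAt_fst.comp x₀ contMDiffAt_snd
    have h3 : ContMDiffAt 𝓘(ℝ, E) 𝓘(ℝ, E →L[ℝ] ℝ) ∞
        (fun p ↦ α₀.inChart x₀.2.1 (ψ x₀.2.1 p)) x₀.2.1 :=
      (hα₀.contDiffAt_inChart x₀.2.1).contMDiffAt.comp x₀.2.1 contMDiffAt_extChartAt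
    exact h3.comp x₀ h2
  have h4 : ContMDiffAt (𝓘(ℝ, ℝ).prod IP) 𝓘(ℝ, Plane) ∞
      (fun x : ℝ × (C × Plane) ↦ x.2.2) x₀ :=
    contMDiffAt_snd.comp x₀ contMDiffAt_snd
  have h5 : ContMDiffAt (𝓘(ℝ, ℝ).prod IP) 𝓘(ℝ, ℝ) ∞
      (fun x : ℝ × (C × Plane) ↦ x.1 * h x.2) x₀ :=
    contMDiffAt_fst.mul (hh.contMDiffAt.comp x₀ contMDiffAt_snd)
  have h6 : ContDiff ℝ ∞ (fun y : (E →L[ℝ] ℝ) × Plane × ℝ ↦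
      y.1.comp (ContinuousLinearMap.fst ℝ E Plane)
        + (rSqDTheta y.2.1 - y.2.2 • dxForm).comp (ContinuousLinearMap.snd ℝ E Plane)) :=
    contDiff_iff_contDiffAt.2 fun y ↦ contDiffAt_modelForm contDiffAt_fst
      (contDiffAt_snd.comp y contDiffAt_snd) (contDiffAt_fst.comp y contDiffAt_snd)
  exact h6.contMDiff.contMDiffAt.comp x₀ (h1.prodMk_space (h4.prodMk_space h5))

theorem smoothFamilyOn_perturbedForm (hα₀ : α₀.SmoothOn univ) (hh : ContMDiff IP 𝓘(ℝ, ℝ) ∞ h)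
    (T : Set ℝ) (U : Set (C × Plane)) :
    SmoothFamilyOn (fun s ↦ perturbedForm α₀ fun q ↦ s * h q) T U := by
  intro x₀ hx
  refine (contMDiffWithinAt_cotangent_iff (fun x : ℝ × (C × Plane) ↦ x.2)
    (fun x ↦ perturbedForm α₀ fun q ↦ x.1 * h q) contMDiffWithinAt_snd hx).2 ?_
  have h7 := contMDiffAt_inChart_perturbedForm hα₀ hh x₀
  refine (h7.congr_of_eventuallyEq ?_).contMDiffWithinAt
  have hev : ∀ᶠ x : ℝ × (C × Plane) in nhds x₀, x.2.1 ∈ (ψ x₀.2.1).source :=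
    (continuousAt_fst.comp continuousAt_snd).eventually
      (extChartAt_source_mem_nhds (I := 𝓘(ℝ, E)) x₀.2.1)
  filter_upwards [hev] with x hx
  have hext : extChartAt IP x₀.2 x.2 = (ψ x₀.2.1 x.2.1, x.2.2) := by
    rw [extChartAt_prod]; rfl
  rw [hext, perturbedForm_inChart _ _ _ ((ψ x₀.2.1).map_source hx)]
  simp only [modelForm, (ψ x₀.2.1).left_inv hx]

theorem smoothOn_perturbedForm (hα₀ : α₀.SmoothOn univ) (hh : ContMDiff IP 𝓘(ℝ, ℝ) ∞ h)
    (s : ℝ) (U : Set (C × Plane)) : (perturbedForm α₀ fun q ↦ s * h q).SmoothOn U :=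
  ContMDiffOn.comp (f := fun q : C × Plane ↦ (s, q))
    (smoothFamilyOn_perturbedForm hα₀ hh univ univ)
    (contMDiff_const.prodMk contMDiff_id).contMDiffOn fun _ _ ↦ ⟨mem_univ _, mem_univ _⟩

/-- The condition on `h` for `α₀ + r² dθ - h dx` to be a contact form. -/
theorem isContactOn_perturbedForm (hα₀ : α₀.IsContactOn univ) (hh : ContMDiff IP 𝓘(ℝ, ℝ) ∞ h)
    (s : ℝ) {U : Set (C × Plane)}
    (hU : ∀ q ∈ U, ∃ R, α₀.IsReebVector q.1 R ∧
      |s * fderiv ℝ (fun z ↦ h (q.1, z)) q.2 !₂[0, 1]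
        - q.2 0 * (s * differential (I := 𝓘(ℝ, E)) (fun p ↦ h (p, q.2)) q.1 R)| < 2) :
    (perturbedForm α₀ fun q ↦ s * h q).IsContactOn U := by
  refine ⟨smoothOn_perturbedForm hα₀.1 hh s U, ?_⟩
  rintro ⟨p, z⟩ hq
  obtain ⟨R, ⟨hR1, hR2⟩, hlt⟩ := hU _ hq
  have hpair := hα₀.isContactPair p
  have hsh : ContMDiff IP 𝓘(ℝ, ℝ) ∞ (fun q ↦ s * h q) := contMDiff_const.mul hh
  have hhC : MDifferentiableAt 𝓘(ℝ, E) 𝓘(ℝ, ℝ) (fun p ↦ h (p, z)) p :=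
    ((hh.comp (f := fun p : C ↦ (p, z)) (contMDiff_id.prodMk contMDiff_const)) p).mdifferentiableAt
      (by simp)
  have hhP : DifferentiableAt ℝ (fun z ↦ h (p, z)) z :=
    (contMDiff_iff_contDiff.1 (hh.comp (f := fun z : Plane ↦ (p, z))
      (contMDiff_const.prodMk contMDiff_id))).contDiffAt.differentiableAt (by simp)
  have e1 := differential_const_mul hhC s R
  have e2 : fderiv ℝ (fun z ↦ s * h (p, z)) z !₂[0, 1] =
      s * fderiv ℝ (fun z ↦ h (p, z)) z !₂[0, 1] := by
    rw [fderiv_const_mul hhP]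
    rfl
  refine ⟨fun h0 ↦ ?_, fun u hu hw ↦ ?_⟩
  · have h1 := perturbedForm_apply α₀ (fun q ↦ s * h q) (p, z) R 0
    have h2 : (perturbedForm α₀ (fun q ↦ s * h q) (p, z) : E × Plane →L[ℝ] ℝ) (R, 0) = 0 :=
      congrArg (fun l : E × Plane →L[ℝ] ℝ ↦ l (R, 0)) h0
    rw [h2, hR1] at h1
    simp at h1
  · obtain ⟨V, ξ⟩ := u
    have := hpair.perturbed_nondegenerate hR1 (fun w ↦ (α₀.d_eq_dForm p R w).symm.trans (hR2 w))
      (differential (I := 𝓘(ℝ, E)) (fun p ↦ s * h (p, z)) p)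
      (fderiv ℝ (fun z ↦ s * h (p, z)) z) z (s * h (p, z)) ?_ (U := V) (ξ := ξ) hu ?_
    · exact Prod.ext this.1 this.2
    · intro h0
      have e3 : (2 : ℝ) + s * fderiv ℝ (fun z ↦ h (p, z)) z !₂[0, 1]
        - z 0 * (s * differential (I := 𝓘(ℝ, E)) (fun p ↦ h (p, z)) p R) = 0 := by
        rw [← e1, ← e2]
        exact h0
      have := (abs_lt.1 hlt).1
      simp only at this
      linarith
    · intro W η hη
      have h1 := hw (W, η) hη
      have h2 := perturbedForm_d hα₀.1 hsh p z V W ξ η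
      rw [α₀.d_eq_dForm] at h2
      exact h2.symm.trans h1

omit [IsManifold 𝓘(ℝ, E) ∞ C] in
theorem isVertical_snd_iff (p : C) (z : Plane) (U : E) (a : Plane) :
    IsVertical (I := IP) 𝓘(ℝ, Plane) (Prod.snd : C × Plane → Plane) (p, z) (U, a) ↔ a = 0 := by
  have h1 : mfderiv IP 𝓘(ℝ, Plane) (Prod.snd : C × Plane → Plane) (p, z) =
      ContinuousLinearMap.snd ℝ E Plane := mfderiv_snd
  have h2 : (mfderiv IP 𝓘(ℝ, Plane) (Prod.snd : C × Plane → Plane) (p, z) :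
      E × Plane →L[ℝ] Plane) (U, a) = a :=
    congrArg (fun l : E × Plane →L[ℝ] Plane ↦ l (U, a)) h1
  exact ⟨fun h ↦ h2.symm.trans h, fun h ↦ h2.trans h⟩

/-- On vertical vectors `dx` and `r² dθ` vanish, so each fibre carries exactly the pair `α₀`, `dα₀`.
-/
theorem isContactFibrationOn_perturbedForm (hα₀ : α₀.IsContactOn univ)
    (hh : ContMDiff IP 𝓘(ℝ, ℝ) ∞ h) {U : Set (C × Plane)}
    (hc : (perturbedForm α₀ h).IsContactOn U) :
    (perturbedForm α₀ h).IsContactFibrationOn 𝓘(ℝ, Plane) Prod.snd U := by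
  refine ⟨hc, ?_⟩
  rintro ⟨p, z⟩ -
  have hpair := hα₀.isContactPair p
  have happ : ∀ V : E, (perturbedForm α₀ h (p, z) : E × Plane →L[ℝ] ℝ) (V, 0) = α₀ p V :=
    fun V ↦ by rw [perturbedForm_apply]; simp
  constructor
  · obtain ⟨V, hV⟩ : ∃ V : E, α₀ p V ≠ 0 := by
      by_contra! hcon
      exact hpair.ne_zero (ContinuousLinearMap.ext hcon)
    exact ⟨(V, (0 : Plane)), (isVertical_snd_iff p z V 0).2 rfl, fun h0 ↦ hV ((happ V).symm.trans h0)⟩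
  · rintro ⟨V, ξ⟩ hv hu hw
    obtain rfl : ξ = 0 := (isVertical_snd_iff p z V ξ).1 hv
    have hV : V = 0 := by
      refine hpair.nondegenerate V ((happ V).symm.trans hu) fun W hW ↦ ?_
      have h1 := hw (W, (0 : Plane)) ((isVertical_snd_iff p z W 0).2 rfl) ((happ W).trans hW)
      have h2 := perturbedForm_d hα₀.1 hh p z V W 0 0
      rw [α₀.d_eq_dForm] at h2
      have h3 := h2.symm.trans h1
      simpa using h3
    exact Prod.ext hV rfl

/-- Against a vertical vector only `dα₀` and the `C`-part of `dh∧dx` survive. -/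
theorem isHorizontal_perturbedForm_iff (hα₀ : α₀.IsContactOn univ)
    (hh : ContMDiff IP 𝓘(ℝ, ℝ) ∞ h) (p : C) (z : Plane) (V : E) (ξ : Plane) :
    (perturbedForm α₀ h).IsHorizontal 𝓘(ℝ, Plane) Prod.snd (p, z) (V, ξ) ↔
      α₀ p V + (rSqDTheta z ξ - h (p, z) * ξ 0) = 0 ∧ ∀ W : E, α₀ p W = 0 →
        α₀.d p V W = -(differential (I := 𝓘(ℝ, E)) (fun p' ↦ h (p', z)) p W * ξ 0) := by
  have happ : ∀ V : E, (perturbedForm α₀ h (p, z) : E × Plane →L[ℝ] ℝ) (V, 0) = α₀ p V :=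
    fun V ↦ by rw [perturbedForm_apply]; simp
  have hd : ∀ W : E, (perturbedForm α₀ h).d (p, z) (V, ξ) (W, (0 : Plane)) =
      α₀.d p V W + differential (I := 𝓘(ℝ, E)) (fun p' ↦ h (p', z)) p W * ξ 0 := fun W ↦ by
    rw [perturbedForm_d hα₀.1 hh]
    simp
  refine and_congr Iff.rfl ⟨fun h1 W hW ↦ ?_, ?_⟩
  · have h2 := h1 (W, (0 : Plane)) ((isVertical_snd_iff p z W 0).2 rfl) ((happ W).trans hW)
    have h3 := (hd W).symm.trans h2
    linarith
  · rintro h1 ⟨W, η⟩ hv hW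
    obtain rfl : η = 0 := (isVertical_snd_iff p z W η).1 hv
    refine (hd W).trans ?_
    rw [h1 W ((happ W).symm.trans hW)]
    ring

end PerturbedContact

/-! ### Cutoff functions and the sector -/

section Cutoff

/-- A smooth step and a smooth bump on the interval `[-δ, δ]`, with bounded derivatives. -/
theorem exists_step_and_bump {δ : ℝ} (hδ : 0 < δ) :
    ∃ (σ χ : ℝ → ℝ) (M N : ℝ), ContDiff ℝ ∞ σ ∧ ContDiff ℝ ∞ χ ∧ (∀ x, σ x ∈ Icc (0 : ℝ) 1) ∧
      (∀ x ≤ 3 * δ / 8, σ x = 0) ∧ (∀ x, 5 * δ / 8 ≤ x → σ x = 1) ∧ χ 0 = 1 ∧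
      (∀ x, χ x ∈ Icc (0 : ℝ) 1) ∧ (∀ x, δ / 8 ≤ |x| → χ x = 0) ∧ 0 ≤ M ∧ 0 ≤ N ∧
      (∀ x, |x| ≤ δ → |deriv σ x| ≤ M) ∧ ∀ x, |x| ≤ δ → |deriv χ x| ≤ N := by
  set σ : ℝ → ℝ := fun x ↦ Real.smoothTransition ((x - 3 * δ / 8) / (δ / 4)) with hσdef
  let χ : ContDiffBump (0 : ℝ) := ⟨δ / 16, δ / 8, by positivity, by linarith⟩
  have hσ : ContDiff ℝ ∞ σ :=
    Real.smoothTransition.contDiff.comp ((contDiff_id.sub contDiff_const).div_const _)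
  have hχ : ContDiff ℝ ∞ χ := χ.contDiff
  have hbd : ∀ {f : ℝ → ℝ}, ContDiff ℝ ∞ f → ∃ M, 0 ≤ M ∧ ∀ x, |x| ≤ δ → |deriv f x| ≤ M := by
    intro f hf
    obtain ⟨M, hM⟩ := (isCompact_Icc (a := -δ) (b := δ)).exists_bound_of_continuousOn
      (hf.continuous_deriv (by simp)).continuousOn
    exact ⟨max M 0, le_max_right _ _, fun x hx ↦ (hM x (abs_le.1 hx)).trans (le_max_left _ _)⟩
  obtain ⟨M, hM0, hM⟩ := hbd hσ
  obtain ⟨N, hN0, hN⟩ := hbd hχ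
  refine ⟨σ, χ, M, N, hσ, hχ, fun x ↦ ⟨Real.smoothTransition.nonneg _,
    Real.smoothTransition.le_one _⟩, fun x hx ↦ ?_, fun x hx ↦ ?_, ?_,
    fun x ↦ ⟨χ.nonneg, χ.le_one⟩, fun x hx ↦ ?_, hM0, hN0, hM, hN⟩
  · exact Real.smoothTransition.zero_of_nonpos
      (div_nonpos_of_nonpos_of_nonneg (by linarith) (by positivity))
  · refine Real.smoothTransition.one_of_one_le ?_
    rw [le_div_iff₀ (by positivity)]
    linarith
  · exact χ.one_of_mem_closedBall (Metric.mem_closedBall_self χ.rIn_pos.le)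
  · refine χ.zero_of_le_dist ?_
    rw [Real.dist_eq, sub_zero]
    exact hx

theorem deriv_eq_zero_of_step {σ : ℝ → ℝ} {a b : ℝ} (h0 : ∀ x ≤ a, σ x = 0)
    (h1 : ∀ x, b ≤ x → σ x = 1) {x : ℝ} (hx : x ∉ Icc a b) : deriv σ x = 0 := by
  rcases lt_or_ge x a with h | h
  · have : σ =ᶠ[nhds x] fun _ ↦ (0 : ℝ) := by
      filter_upwards [Iio_mem_nhds h] with y hy using h0 y (le_of_lt hy)
    rw [this.deriv_eq, deriv_const]
  · have hb : b < x := not_le.1 fun h' ↦ hx ⟨h, h'⟩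
    have : σ =ᶠ[nhds x] fun _ ↦ (1 : ℝ) := by
      filter_upwards [Ioi_mem_nhds hb] with y hy using h1 y (le_of_lt hy)
    rw [this.deriv_eq, deriv_const]

/-- The rectangle supporting the cutoffs fits in the sector: its slopes are at most `(δ/8)/(3δ/8) =
1/3 < 1`, and its radii at most `(5δ/8)(6/5) = 3δ/4`, since `√(1 + 1/9) < 6/5`. -/
theorem mem_sector {δ : ℝ} (hδ : 0 < δ) {z : Plane} (h0 : z 0 ∈ Icc (3 * δ / 8) (5 * δ / 8))
    (h1 : |z 1| < δ / 8) : z ∈ sector δ := by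
  have hx : 0 < z 0 := by linarith [h0.1]
  set t := z 1 / z 0 with ht
  have hy := abs_lt.1 h1
  have ht1 : |t| ≤ 1 / 3 := by
    rw [ht, abs_div, abs_of_pos hx, div_le_iff₀ hx]
    linarith [h0.1]
  have ht2 := abs_le.1 ht1
  have hpos : 0 < √(1 + t ^ 2) := Real.sqrt_pos.2 (by positivity)
  have hs1 : 1 ≤ √(1 + t ^ 2) := Real.one_le_sqrt.2 (by nlinarith)
  have hs2 : √(1 + t ^ 2) ≤ 6 / 5 := Real.sqrt_le_iff.2 ⟨by norm_num, by nlinarith⟩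
  refine ⟨z 0 * √(1 + t ^ 2), ⟨?_, ?_⟩, Real.arctan t, ⟨?_, ?_⟩, ?_⟩
  · nlinarith [h0.1]
  · nlinarith [h0.2]
  · rw [← Real.arctan_one, ← Real.arctan_neg]
    exact Real.arctan_strictMono.monotone (by linarith)
  · rw [← Real.arctan_one]
    exact Real.arctan_strictMono.monotone (by linarith)
  · ext i
    fin_cases i
    · simp [Real.cos_arctan]
      field_simp
    · simp [Real.sin_arctan, ht]
      field_simp

theorem abs_apply_le_norm (z : Plane) (i : Fin 2) : |z i| ≤ ‖z‖ := PiLp.norm_apply_le z i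

end Cutoff

/-! ### Curves over the radial path -/

section Lifts

variable {E : Type*} [NormedAddCommGroup E] [NormedSpace ℝ E]
  {C : Type*} [TopologicalSpace C] [ChartedSpace E C]

/-- A solution on `[a, b]` of a vector field that vanishes outside of the open interval extends to
all times. -/
theorem isSolutionAt_extend {X : ∀ (_ : ℝ) (p : C), TangentSpace 𝓘(ℝ, E) p} {a b : ℝ} (hab : a < b)
    (h0 : ∀ t ∉ Ioo a b, ∀ p, X t p = 0) {c : ℝ → C}
    (hc : ∀ t ∈ Icc a b, HasVelocity (I := 𝓘(ℝ, E)) c a b t (X t (c t))) (t : ℝ) :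
    IsSolutionAt X (fun t ↦ c (projIcc a b hab.le t)) t := by
  have hzero : ∀ {t : ℝ}, t ∉ Ioo a b → ∀ p, ((1 : ℝ →L[ℝ] ℝ).smulRight (X t p : E)) = 0 := by
    intro t ht p
    have : (X t p : E) = 0 := h0 t ht p
    rw [this]
    ext
    simp
  have hin : ∀ t ∈ Icc a b, HasMFDerivWithinAt 𝓘(ℝ, ℝ) 𝓘(ℝ, E)
      (fun t ↦ c (projIcc a b hab.le t)) (Icc a b) t
      ((1 : ℝ →L[ℝ] ℝ).smulRight (X t (c (projIcc a b hab.le t)) : E)) := by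
    intro t ht
    have h1 := hc t ht
    have h2 : c (projIcc a b hab.le t) = c t := by rw [projIcc_of_mem _ ht]
    rw [h2]
    exact HasMFDerivWithinAt.congr_of_eventuallyEq h1
      (by filter_upwards [self_mem_nhdsWithin] with s hs; rw [projIcc_of_mem _ hs]) h2
  have hlow : ∀ t ≤ a, HasMFDerivWithinAt 𝓘(ℝ, ℝ) 𝓘(ℝ, E)
      (fun t ↦ c (projIcc a b hab.le t)) (Iic a) t
      ((1 : ℝ →L[ℝ] ℝ).smulRight (X t (c (projIcc a b hab.le t)) : E)) := by
    intro t ht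
    rw [hzero fun h ↦ absurd h.1 (not_lt.2 ht)]
    refine ((hasMFDerivAt_const (c a) t).hasMFDerivWithinAt (s := Iic a)).congr_of_eventuallyEq
      ?_ (by rw [projIcc_of_le_left _ ht])
    filter_upwards [self_mem_nhdsWithin] with s hs
    rw [projIcc_of_le_left _ hs]
  have hhigh : ∀ t, b ≤ t → HasMFDerivWithinAt 𝓘(ℝ, ℝ) 𝓘(ℝ, E)
      (fun t ↦ c (projIcc a b hab.le t)) (Ici b) t
      ((1 : ℝ →L[ℝ] ℝ).smulRight (X t (c (projIcc a b hab.le t)) : E)) := by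
    intro t ht
    rw [hzero fun h ↦ absurd h.2 (not_lt.2 ht)]
    refine ((hasMFDerivAt_const (c b) t).hasMFDerivWithinAt (s := Ici b)).congr_of_eventuallyEq
      ?_ (by rw [projIcc_of_right_le _ ht])
    filter_upwards [self_mem_nhdsWithin] with s hs
    rw [projIcc_of_right_le _ hs]
  -- Beyond the interval the extended curve is constant and the field is zero. At `a` and `b` the
  -- one-sided velocities therefore agree and glue.
  rcases lt_trichotomy t a with h | rfl | h
  · exact (hlow t h.le).hasMFDerivAt (Iic_mem_nhds h)
  · refine ((hlow t le_rfl).union (hin t (left_mem_Icc.2 hab.le))).hasMFDerivAt ?_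
    rw [Iic_union_Icc_eq_Iic hab.le]
    exact Iic_mem_nhds hab
  rcases lt_trichotomy t b with h' | rfl | h'
  · exact (hin t ⟨h.le, h'.le⟩).hasMFDerivAt (Icc_mem_nhds h h')
  · refine ((hin t (right_mem_Icc.2 hab.le)).union (hhigh t le_rfl)).hasMFDerivAt ?_
    rw [Icc_union_Ici_eq_Ici hab.le]
    exact Ici_mem_nhds hab
  · exact (hhigh t h'.le).hasMFDerivAt (Ici_mem_nhds h')

theorem hasDerivAt_radialPath (δ t : ℝ) :
    HasDerivAt (radialPath δ) !₂[(1 / 2 : ℝ), 0] t := by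
  have h1 : radialPath δ = fun t ↦ t • !₂[(1 / 2 : ℝ), 0] + !₂[δ / 4, 0] := by
    funext t
    ext i
    fin_cases i
    · simp [radialPath]
      ring
    · simp [radialPath]
  rw [h1]
  simpa using ((hasDerivAt_id t).smul_const !₂[(1 / 2 : ℝ), 0]).add_const !₂[δ / 4, 0]

local notation "IP" => ModelWithCorners.prod 𝓘(ℝ, E) 𝓘(ℝ, Plane)

theorem hasVelocity_prodMk_radialPath {e : ℝ → C} {δ t : ℝ} {V : TangentSpace 𝓘(ℝ, E) (e t)}
    (he : HasVelocity (I := 𝓘(ℝ, E)) e 0 δ t V) :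
    HasVelocity (I := IP) (fun t ↦ (e t, radialPath δ t)) 0 δ t
      ((V : E), !₂[(1 / 2 : ℝ), 0]) := by
  have h1 := (hasDerivAt_radialPath δ t).hasFDerivAt.hasMFDerivAt.hasMFDerivWithinAt (s := Icc 0 δ)
  exact (he.prodMk h1).congr_mfderiv (ContinuousLinearMap.ext fun (r : ℝ) ↦ rfl)

/-- A curve over the radial path has the velocity of the radial path as its plane component. -/
theorem HasVelocity.of_snd_eq_radialPath {c : ℝ → C × Plane} {δ t : ℝ} (hδ : 0 < δ)
    (ht : t ∈ Icc 0 δ) (hc : ∀ s ∈ Icc 0 δ, (c s).2 = radialPath δ s)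
    {V : E} {ξ : Plane} (h : HasVelocity (I := IP) c 0 δ t (V, ξ)) :
    HasVelocity (I := 𝓘(ℝ, E)) (fun s ↦ (c s).1) 0 δ t V ∧ ξ = !₂[(1 / 2 : ℝ), 0] := by
  have h1 : HasMFDerivWithinAt 𝓘(ℝ, ℝ) 𝓘(ℝ, E) (fun s ↦ (c s).1) (Icc 0 δ) t
      ((ContinuousLinearMap.fst ℝ E Plane).comp ((1 : ℝ →L[ℝ] ℝ).smulRight (V, ξ))) :=
    HasMFDerivAt.comp_hasMFDerivWithinAt (g := Prod.fst) t (hasMFDerivAt_fst (c t)) h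
  have h2 : HasMFDerivWithinAt 𝓘(ℝ, ℝ) 𝓘(ℝ, Plane) (fun s ↦ (c s).2) (Icc 0 δ) t
      ((ContinuousLinearMap.snd ℝ E Plane).comp ((1 : ℝ →L[ℝ] ℝ).smulRight (V, ξ))) :=
    HasMFDerivAt.comp_hasMFDerivWithinAt (g := Prod.snd) t (hasMFDerivAt_snd (c t)) h
  refine ⟨h1.congr_mfderiv (ContinuousLinearMap.ext fun (r : ℝ) ↦ rfl), ?_⟩
  have h3 : HasFDerivWithinAt (fun s ↦ (c s).2)
      ((ContinuousLinearMap.snd ℝ E Plane).comp ((1 : ℝ →L[ℝ] ℝ).smulRight (V, ξ))) (Icc 0 δ) t :=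
    h2.hasFDerivWithinAt
  have h4 := ((hasDerivAt_radialPath δ t).hasFDerivAt.hasFDerivWithinAt (s := Icc 0 δ)).congr hc
    (hc t ht)
  -- One-sided derivatives on a nondegenerate interval are unique, end points included.
  have h5 := (uniqueDiffOn_Icc hδ t ht).eq h3 h4
  simpa using congrArg (fun l : ℝ →L[ℝ] Plane ↦ l 1) h5

theorem hasVelocity_comp {e : ℝ → C} {κ : ℝ → ℝ} {δ t : ℝ} (hκ : DifferentiableAt ℝ κ t)
    (hκ01 : ∀ s, κ s ∈ Icc (0 : ℝ) 1) {V : TangentSpace 𝓘(ℝ, E) (e (κ t))}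
    (he : HasVelocity (I := 𝓘(ℝ, E)) e 0 1 (κ t) V) :
    HasVelocity (I := 𝓘(ℝ, E)) (fun t ↦ e (κ t)) 0 δ t (deriv κ t • V) := by
  have h1 := hκ.hasDerivAt.hasFDerivAt.hasMFDerivAt.hasMFDerivWithinAt (s := Icc 0 δ)
  refine (HasMFDerivWithinAt.comp t he h1 fun s _ ↦ hκ01 s).congr_mfderiv
    (ContinuousLinearMap.ext fun (r : ℝ) ↦ ?_)
  exact mul_smul r (deriv κ t) (V : E)

end Lifts

/-! ### Monodromy along the radial path -/

section Monodromy

variable {E : Type*} [NormedAddCommGroup E] [NormedSpace ℝ E] [FiniteDimensional ℝ E]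
  {C : Type*} [TopologicalSpace C] [ChartedSpace E C] [IsManifold 𝓘(ℝ, E) ∞ C]
  {α₀ : OneForm 𝓘(ℝ, E) C} {h : C × Plane → ℝ} {g : ℝ → C → ℝ} {κ : ℝ → ℝ} {δ : ℝ}

local notation "IP" => ModelWithCorners.prod 𝓘(ℝ, E) 𝓘(ℝ, Plane)

/-- Over the radial path the contact connection is given by the Hamiltonian field. -/
theorem isHorizontal_radialPath_iff (hα₀ : α₀.IsContactOn univ) (hh : ContMDiff IP 𝓘(ℝ, ℝ) ∞ h)
    (hg : ContMDiffOn (𝓘(ℝ, ℝ).prod 𝓘(ℝ, E)) 𝓘(ℝ, ℝ) ∞ (fun q : ℝ × C ↦ g q.1 q.2)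
      (Icc 0 1 ×ˢ univ)) (hκ : ContDiff ℝ ∞ κ) (hκ01 : ∀ s, κ s ∈ Icc (0 : ℝ) 1) {t : ℝ}
    (hgh : ∀ p, h (p, radialPath δ t) = (2 * deriv κ t) * g (κ t) p) (p : C) (V : E) :
    (perturbedForm α₀ h).IsHorizontal 𝓘(ℝ, Plane) Prod.snd (p, radialPath δ t)
      (V, !₂[(1 / 2 : ℝ), 0]) ↔ V = reparamField α₀ g κ t p := by
  have hd : ∀ q, MDifferentiableAt 𝓘(ℝ, E) 𝓘(ℝ, ℝ) (g (κ t)) q := fun q ↦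
    mdifferentiableAt_slice (contMDiff_reparam hg hκ hκ01) t q
  have hfun : (fun p' ↦ h (p', radialPath δ t)) = fun p' ↦ (2 * deriv κ t) * g (κ t) p' :=
    funext hgh
  have hdh : ∀ W : E, differential (I := 𝓘(ℝ, E)) (fun p' ↦ h (p', radialPath δ t)) p W
      * (!₂[(1 / 2 : ℝ), 0] : Plane) 0 =
        differential (I := 𝓘(ℝ, E)) (fun p' ↦ deriv κ t * g (κ t) p') p W := fun W ↦ by
    have h1 := differential_const_mul (hd p) (2 * deriv κ t) W
    have h2 := differential_const_mul (hd p) (deriv κ t) W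
    rw [hfun]
    refine (congrArg (· * (!₂[(1 / 2 : ℝ), 0] : Plane) 0) h1).trans (Eq.trans ?_ h2.symm)
    simp
    ring
  -- On `y = 0` the radial direction is killed by `r² dθ`, and the speed `1/2` of the path absorbs
  -- the factor 2 in `hgh`.
  have hval : rSqDTheta (radialPath δ t) !₂[(1 / 2 : ℝ), 0]
      - h (p, radialPath δ t) * (!₂[(1 / 2 : ℝ), 0] : Plane) 0 = -(deriv κ t * g (κ t) p) := by
    rw [rSqDTheta_apply, hgh]
    simp [radialPath]
    ring
  have hham : reparamField α₀ g κ t p = α₀.ham (fun p' ↦ deriv κ t * g (κ t) p') p :=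
    (hα₀.ham_const_mul (hd p) _).symm
  rw [isHorizontal_perturbedForm_iff hα₀ hh, hval, hham]
  constructor
  · rintro ⟨h1, h2⟩
    refine hα₀.eq_ham (by linarith) fun W hW ↦ ?_
    exact (h2 W hW).trans (congrArg Neg.neg (hdh W))
  · rintro rfl
    obtain ⟨h1, R, -, h2⟩ := hα₀.isHamiltonianVector_ham (fun p' ↦ deriv κ t * g (κ t) p') p
    refine ⟨by rw [h1]; ring, fun W hW ↦ (h2 W).trans ?_⟩
    rw [hW, mul_zero, zero_sub]
    exact congrArg Neg.neg (hdh W).symm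

/-- The curves `φ (κ t) p` are lifts by the chain rule. For uniqueness, any two lifts extend by
constants to all times, since `κ' = 0` outside `(0, δ)`, and solutions on the whole line are unique.
-/
theorem isMonodromy_perturbedForm [T2Space C] (hα₀ : α₀.IsContactOn univ)
    (hh : ContMDiff IP 𝓘(ℝ, ℝ) ∞ h)
    (hg : ContMDiffOn (𝓘(ℝ, ℝ).prod 𝓘(ℝ, E)) 𝓘(ℝ, ℝ) ∞ (fun q : ℝ × C ↦ g q.1 q.2)
      (Icc 0 1 ×ˢ univ)) (hκ : ContDiff ℝ ∞ κ) (hκ01 : ∀ s, κ s ∈ Icc (0 : ℝ) 1) (hδ : 0 < δ)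
    (hκ0 : κ 0 = 0) (hκδ : κ δ = 1) (hκd : ∀ t ∉ Ioo 0 δ, deriv κ t = 0)
    (hgh : ∀ t p, h (p, radialPath δ t) = (2 * deriv κ t) * g (κ t) p) {φ : ℝ → C → C}
    (hφ0 : ∀ p, φ 0 p = p) (hφ : ∀ p, ∀ t ∈ Icc (0 : ℝ) 1,
      HasVelocity (I := 𝓘(ℝ, E)) (fun s ↦ φ s p) 0 1 t (α₀.ham (g t) (φ t p))) :
    (perturbedForm α₀ h).IsMonodromy 𝓘(ℝ, Plane) Prod.snd (radialPath δ) 0 δ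
      (fun q ↦ (φ 1 q.1, radialPath δ δ)) := by
  have : CompleteSpace E := FiniteDimensional.complete ℝ E
  have hvel : ∀ p, ∀ t ∈ Icc 0 δ, HasVelocity (I := 𝓘(ℝ, E)) (fun t ↦ φ (κ t) p) 0 δ t
      (reparamField α₀ g κ t (φ (κ t) p)) := fun p t _ ↦
    hasVelocity_comp (e := fun s ↦ φ s p) (hκ.differentiable (by simp) t) hκ01
      (hφ p (κ t) (hκ01 t))
  rintro ⟨p, z⟩ hz
  obtain rfl : z = radialPath δ 0 := hz
  refine ⟨⟨fun t ↦ (φ (κ t) p, radialPath δ t), fun t ht ↦ ⟨rfl, _,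
    hasVelocity_prodMk_radialPath (hvel p t ht), ?_⟩, ?_⟩, fun c hc hc0 ↦ ?_⟩
  · exact (isHorizontal_radialPath_iff hα₀ hh hg hκ hκ01 (hgh t) _ _).2 rfl
  · simp only [hκ0, hφ0]
  · have hsnd : ∀ s ∈ Icc 0 δ, (c s).2 = radialPath δ s := fun s hs ↦ (hc s hs).1
    have hfst : ∀ t ∈ Icc 0 δ, HasVelocity (I := 𝓘(ℝ, E)) (fun s ↦ (c s).1) 0 δ t
        (reparamField α₀ g κ t (c t).1) := by
      intro t ht
      obtain ⟨-, ⟨V, ξ⟩, hv, hhor⟩ := hc t ht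
      obtain ⟨h1, rfl⟩ := HasVelocity.of_snd_eq_radialPath hδ ht hsnd hv
      have hct : c t = ((c t).1, radialPath δ t) := Prod.ext rfl (hsnd t ht)
      have h2 : (perturbedForm α₀ h).IsHorizontal 𝓘(ℝ, Plane) Prod.snd ((c t).1, radialPath δ t)
          ((V, !₂[(1 / 2 : ℝ), 0]) : E × Plane) :=
        (congrArg (fun q ↦ (perturbedForm α₀ h).IsHorizontal 𝓘(ℝ, Plane) Prod.snd q
          ((V, !₂[(1 / 2 : ℝ), 0]) : E × Plane)) hct).mp hhor
      have h3 := (isHorizontal_radialPath_iff hα₀ hh hg hκ hκ01 (hgh t) _ _).1 h2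
      rwa [h3] at h1
    have hX := hα₀.contMDiff_reparamField hg hκ hκ01
    have hX0 : ∀ t ∉ Ioo 0 δ, ∀ p, reparamField α₀ g κ t p = 0 := fun t ht p ↦ by
      rw [reparamField, hκd t ht, zero_smul]
    have heq := IsSolutionAt.eq hX (isSolutionAt_extend hδ hX0 hfst)
      (isSolutionAt_extend hδ hX0 (hvel p)) (t₀ := 0)
      (by simp only [projIcc_left, hc0, hκ0, hφ0])
    have h1 := congrFun heq δ
    simp only [projIcc_right, hκδ] at h1
    exact Prod.ext h1 (hsnd δ (right_mem_Icc.2 hδ.le))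

end Monodromy

/-! ### Estimates for the perturbing function -/

section SmallHamiltonian

variable {E : Type*} [NormedAddCommGroup E] [NormedSpace ℝ E]
  {C : Type*} [TopologicalSpace C] [ChartedSpace E C] [IsManifold 𝓘(ℝ, E) ∞ C]

theorem IsSmallHamiltonian.abs_differential_le
    {m : Bundle.ContMDiffRiemannianMetric 𝓘(ℝ, E) ∞ E (fun p : C ↦ TangentSpace 𝓘(ℝ, E) p)}
    {ε : ℝ} {g : ℝ → C → ℝ} (hg : IsSmallHamiltonian m ε g) {t : ℝ} (ht : t ∈ Icc (0 : ℝ) 1)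
    (p : C) (v : TangentSpace 𝓘(ℝ, E) p) :
    |differential (I := 𝓘(ℝ, E)) (g t) p v| ≤ ε * √(m.inner p v v) := by
  -- Time component 0 leaves only the derivative of `g t` along `C`.
  have h1 := (hg.2 t ht p).2 0 v
  have h2 : HasMFDerivAt 𝓘(ℝ, E) (𝓘(ℝ, ℝ).prod 𝓘(ℝ, E)) (fun q : C ↦ (t, q)) p
      ((0 : E →L[ℝ] ℝ).prod (ContinuousLinearMap.id ℝ E)) :=
    (hasMFDerivAt_const t p).prodMk (hasMFDerivAt_id p)
  have h3 : MDifferentiableWithinAt (𝓘(ℝ, ℝ).prod 𝓘(ℝ, E)) 𝓘(ℝ, ℝ)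
      (fun q : ℝ × C ↦ g q.1 q.2) (Icc 0 1 ×ˢ univ) (t, p) :=
    (hg.1 (t, p) ⟨ht, mem_univ _⟩).mdifferentiableWithinAt (by simp)
  have h4 := (h3.hasMFDerivWithinAt.comp p (h2.hasMFDerivWithinAt (s := univ))
    fun q _ ↦ ⟨ht, mem_univ _⟩).hasMFDerivAt Filter.univ_mem
  have h5 : differential (I := 𝓘(ℝ, E)) (g t) p v =
      differentialWithin (I := 𝓘(ℝ, ℝ).prod 𝓘(ℝ, E)) (fun q : ℝ × C ↦ g q.1 q.2)
        (Icc 0 1 ×ˢ univ) (t, p) ((0 : ℝ), v) :=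
    congrArg (fun l : E →L[ℝ] ℝ ↦ l v) h4.mfderiv
  rw [h5]
  refine h1.trans (le_of_eq ?_)
  rw [zero_pow two_ne_zero, zero_add]

end SmallHamiltonian

section PerturbationFunction

variable {E : Type*} [NormedAddCommGroup E] [NormedSpace ℝ E]
  {C : Type*} [TopologicalSpace C] [ChartedSpace E C]

/-- The function `(p, x, y) ↦ χ(y) σ'(x) g_{σ(x)}(p)`. -/
noncomputable def cutoffHamiltonian (σ χ : ℝ → ℝ) (g : ℝ → C → ℝ) (q : C × Plane) : ℝ :=
  χ (q.2 1) * deriv σ (q.2 0) * g (σ (q.2 0)) q.1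

variable {σ χ : ℝ → ℝ} {g : ℝ → C → ℝ}

theorem contMDiff_cutoffHamiltonian (hσ : ContDiff ℝ ∞ σ) (hχ : ContDiff ℝ ∞ χ)
    (hσ01 : ∀ x, σ x ∈ Icc (0 : ℝ) 1)
    (hg : ContMDiffOn (𝓘(ℝ, ℝ).prod 𝓘(ℝ, E)) 𝓘(ℝ, ℝ) ∞ (fun q : ℝ × C ↦ g q.1 q.2)
      (Icc 0 1 ×ˢ univ)) :
    ContMDiff (𝓘(ℝ, E).prod 𝓘(ℝ, Plane)) 𝓘(ℝ, ℝ) ∞ (cutoffHamiltonian σ χ g) := by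
  have hlin : ∀ i, ContMDiff (𝓘(ℝ, E).prod 𝓘(ℝ, Plane)) 𝓘(ℝ, ℝ) ∞
      (fun q : C × Plane ↦ q.2 i) := fun i ↦
    (EuclideanSpace.proj i : Plane →L[ℝ] ℝ).contDiff.contMDiff.comp contMDiff_snd
  have hσ' : ContDiff ℝ ∞ (deriv σ) := (contDiff_infty_iff_deriv.1 hσ).2
  have h1 := (contMDiff_reparam hg hσ hσ01).comp
    (f := fun q : C × Plane ↦ (q.2 0, q.1)) ((hlin 0).prodMk contMDiff_fst)
  exact ((hχ.contMDiff.comp (hlin 1)).mul (hσ'.contMDiff.comp (hlin 0))).mul h1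

theorem fderiv_cutoffHamiltonian (hσ : ContDiff ℝ ∞ σ) (hχ : ContDiff ℝ ∞ χ)
    (hσ01 : ∀ x, σ x ∈ Icc (0 : ℝ) 1)
    (hg : ContMDiffOn (𝓘(ℝ, ℝ).prod 𝓘(ℝ, E)) 𝓘(ℝ, ℝ) ∞ (fun q : ℝ × C ↦ g q.1 q.2)
      (Icc 0 1 ×ˢ univ)) (p : C) (z : Plane) :
    fderiv ℝ (fun z ↦ cutoffHamiltonian σ χ g (p, z)) z !₂[0, 1] =
      deriv χ (z 1) * deriv σ (z 0) * g (σ (z 0)) p := by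
  have h1 : DifferentiableAt ℝ (fun z ↦ cutoffHamiltonian σ χ g (p, z)) z :=
    (contMDiff_iff_contDiff.1 ((contMDiff_cutoffHamiltonian hσ hχ hσ01 hg).comp
      (f := fun z : Plane ↦ (p, z))
      (contMDiff_const.prodMk contMDiff_id))).contDiffAt.differentiableAt (by simp)
  -- Restricting to a line in the `y` direction leaves `χ` as the only varying factor.
  have h2 : HasDerivAt (fun s : ℝ ↦ z + s • (!₂[0, 1] : Plane)) !₂[0, 1] 0 := by
    simpa using ((hasDerivAt_id (0 : ℝ)).smul_const (!₂[0, 1] : Plane)).const_add z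
  have h3 : HasDerivAt (fun s : ℝ ↦ cutoffHamiltonian σ χ g (p, z + s • (!₂[0, 1] : Plane)))
      (fderiv ℝ (fun z ↦ cutoffHamiltonian σ χ g (p, z)) z !₂[0, 1]) 0 :=
    HasFDerivAt.comp_hasDerivAt_of_eq (0 : ℝ) h1.hasFDerivAt h2 (by simp)
  have h4 : HasDerivAt (fun s : ℝ ↦ χ (z 1 + s)) (deriv χ (z 1)) 0 :=
    HasDerivAt.comp_const_add (z 1) 0
      (by simpa using (hχ.differentiable (by simp) (z 1)).hasDerivAt)
  have h5 := (h4.mul_const (deriv σ (z 0))).mul_const (g (σ (z 0)) p)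
  refine h3.unique (h5.congr_of_eventuallyEq (Filter.Eventually.of_forall fun s ↦ ?_))
  simp [cutoffHamiltonian]

theorem differential_cutoffHamiltonian (hσ : ContDiff ℝ ∞ σ) (hσ01 : ∀ x, σ x ∈ Icc (0 : ℝ) 1)
    (hg : ContMDiffOn (𝓘(ℝ, ℝ).prod 𝓘(ℝ, E)) 𝓘(ℝ, ℝ) ∞ (fun q : ℝ × C ↦ g q.1 q.2)
      (Icc 0 1 ×ˢ univ)) (p : C) (z : Plane) (v : TangentSpace 𝓘(ℝ, E) p) :
    differential (I := 𝓘(ℝ, E)) (fun p ↦ cutoffHamiltonian σ χ g (p, z)) p v =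
      χ (z 1) * deriv σ (z 0) * differential (I := 𝓘(ℝ, E)) (g (σ (z 0))) p v :=
  have h1 : MDifferentiableAt 𝓘(ℝ, E) 𝓘(ℝ, ℝ) (g (σ (z 0))) p :=
    mdifferentiableAt_slice (contMDiff_reparam hg hσ hσ01) (z 0) p
  differential_const_mul h1 (χ (z 1) * deriv σ (z 0)) v

end PerturbationFunction

/-! ### Choice of `ε` and conclusion -/

theorem mainTheorem8
    {E : Type*} [NormedAddCommGroup E] [NormedSpace ℝ E] [FiniteDimensional ℝ E]
    {C : Type*} [TopologicalSpace C] [T2Space C] [CompactSpace C]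
    [ChartedSpace E C] [IsManifold 𝓘(ℝ, E) ∞ C]
    (m : Bundle.ContMDiffRiemannianMetric 𝓘(ℝ, E) ∞ E (fun p : C ↦ TangentSpace 𝓘(ℝ, E) p))
    (α₀ : OneForm 𝓘(ℝ, E) C) (hα₀ : α₀.IsContactOn univ)
    (δ : ℝ) (hδ : 0 < δ) :
    ∃ ε : ℝ, 0 < ε ∧ ∀ g : ℝ → C → ℝ, IsSmallHamiltonian m ε g →
      ∃ (αbar : OneForm (𝓘(ℝ, E).prod 𝓘(ℝ, Plane)) (C × Plane))
        (A : ℝ → OneForm (𝓘(ℝ, E).prod 𝓘(ℝ, Plane)) (C × Plane))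
        (φ : ℝ → C → C),
        IsContactIsotopyOn (stdProductForm α₀) αbar A
          (univ ×ˢ Metric.ball 0 δ) (univ ×ˢ sector δ) ∧
        αbar.IsContactFibrationOn 𝓘(ℝ, Plane) Prod.snd (univ ×ˢ Metric.ball 0 δ) ∧
        α₀.IsHamiltonianFlow g φ ∧
        αbar.IsMonodromy 𝓘(ℝ, Plane) Prod.snd (radialPath δ) 0 δ
          (fun q ↦ (φ 1 q.1, radialPath δ δ)) := by
  obtain ⟨σ, χ, M, N, hσ, hχ, hσ01, hσ0, hσ1, hχ0, hχ01, hχs, hM0, hN0, hM, hN⟩ :=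
    exists_step_and_bump hδ
  obtain ⟨K, hK0, hK⟩ := hα₀.exists_reeb_bound m
  have hden : 0 < N * M + δ * (M * K) + 1 := by positivity
  -- On the disc, `|∂_y h| ≤ N M ε` and `|x dh(R)| ≤ δ M K ε`. This `ε` makes their sum at most 1,
  -- hence below the 2 coming from `2 dx∧dy`; the `+ 1` keeps the denominator positive.
  refine ⟨(N * M + δ * (M * K) + 1)⁻¹, inv_pos.2 hden, fun g hg ↦ ?_⟩
  set ε := (N * M + δ * (M * K) + 1)⁻¹ with hε
  have hε0 : 0 < ε := inv_pos.2 hden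
  have hε1 : (N * M + δ * (M * K)) * ε ≤ 1 := by
    rw [hε, ← div_eq_mul_inv, div_le_one hden]
    linarith
  set h := cutoffHamiltonian σ χ g with hh
  have hsm : ContMDiff (𝓘(ℝ, E).prod 𝓘(ℝ, Plane)) 𝓘(ℝ, ℝ) ∞ h :=
    contMDiff_cutoffHamiltonian hσ hχ hσ01 hg.1
  have hsupp : ∀ q ∉ (univ : Set C) ×ˢ sector δ, h q = 0 := by
    intro q hq
    by_contra hne
    refine hq ⟨mem_univ _, mem_sector hδ ?_ ?_⟩
    · by_contra h1
      exact hne (by simp [hh, cutoffHamiltonian, deriv_eq_zero_of_step hσ0 hσ1 h1])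
    · by_contra! h1
      exact hne (by simp [hh, cutoffHamiltonian, hχs _ h1])
  have hcontact : ∀ s ∈ Icc (0 : ℝ) 1,
      (perturbedForm α₀ fun q ↦ s * h q).IsContactOn (univ ×ˢ Metric.ball 0 δ) := by
    intro s hs
    refine isContactOn_perturbedForm hα₀ hsm s fun q hq ↦ ?_
    obtain ⟨p, z⟩ := q
    obtain ⟨R, hR, hRK⟩ := hK p
    have hz : ∀ i, |z i| ≤ δ := fun i ↦
      (abs_apply_le_norm z i).trans (mem_ball_zero_iff.1 hq.2).le
    refine ⟨R, hR, ?_⟩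
    have h1 : |deriv χ (z 1) * deriv σ (z 0) * g (σ (z 0)) p| ≤ N * M * ε := by
      rw [abs_mul, abs_mul]
      exact mul_le_mul (mul_le_mul (hN _ (hz 1)) (hM _ (hz 0)) (abs_nonneg _) hN0)
        (hg.2 _ (hσ01 _) p).1 (abs_nonneg _) (by positivity)
    have h2 : |χ (z 1) * deriv σ (z 0) * differential (I := 𝓘(ℝ, E)) (g (σ (z 0))) p R| ≤
        M * (ε * K) := by
      rw [abs_mul, abs_mul, abs_of_nonneg (hχ01 _).1]
      refine mul_le_mul ?_ ((hg.abs_differential_le (hσ01 _) p R).trans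
        (mul_le_mul_of_nonneg_left hRK hε0.le)) (abs_nonneg _) hM0
      exact (mul_le_of_le_one_left (abs_nonneg _) (hχ01 _).2).trans (hM _ (hz 0))
    rw [fderiv_cutoffHamiltonian hσ hχ hσ01 hg.1,
      differential_cutoffHamiltonian hσ hσ01 hg.1]
    set a := deriv χ (z 1) * deriv σ (z 0) * g (σ (z 0)) p
    set b := χ (z 1) * deriv σ (z 0) * differential (I := 𝓘(ℝ, E)) (g (σ (z 0))) p R
    have h3 : |z 0 * b| ≤ δ * (M * (ε * K)) := by
      rw [abs_mul]
      exact mul_le_mul (hz 0) h2 (abs_nonneg _) hδ.le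
    have h4 : |a - z 0 * b| ≤ 1 := (abs_sub _ _).trans (by linarith)
    have h5 : s * a - z 0 * (s * b) = s * (a - z 0 * b) := by ring
    have h6 : |s * a - z 0 * (s * b)| ≤ 1 := by
      rw [h5, abs_mul, abs_of_nonneg hs.1]
      exact mul_le_one₀ hs.2 (abs_nonneg _) h4
    exact h6.trans_lt one_lt_two
  have hone : (fun q ↦ (1 : ℝ) * h q) = h := funext fun q ↦ one_mul _
  obtain ⟨φ, hφ0, hφ⟩ := hα₀.exists_hamiltonianFlow hg.1
  refine ⟨perturbedForm α₀ h, fun s ↦ perturbedForm α₀ fun q ↦ s * h q, φ,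
    ⟨smoothFamilyOn_perturbedForm hα₀.1 hsm _ _, hcontact, ?_, ?_, fun s _ q hq ↦ ?_⟩,
    isContactFibrationOn_perturbedForm hα₀ hsm ?_,
    ⟨hφ0, fun p t ht ↦ ⟨_, hα₀.isHamiltonianVector_ham (g t) (φ t p), hφ p t ht⟩⟩, ?_⟩
  · exact funext fun q ↦ perturbedForm_zero α₀ (zero_mul _)
  · exact congrArg (perturbedForm α₀) hone
  · exact perturbedForm_zero α₀ (by rw [hsupp q hq, mul_zero])
  · have := hcontact 1 (right_mem_Icc.2 zero_le_one)
    rwa [hone] at this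
  -- `κ` is `σ` along the path, whose abscissa runs from `δ/4` to `3δ/4`. These ends lie beyond the
  -- transition interval of `σ`, so `κ 0 = 0` and `κ δ = 1`.
  · set κ : ℝ → ℝ := fun t ↦ σ ((1 / 2) * (t + (1 / 2) * δ)) with hκdef
    have hκd : ∀ t, deriv κ t = deriv σ ((1 / 2) * (t + (1 / 2) * δ)) * (1 / 2) := fun t ↦ by
      have h1 : HasDerivAt (fun t : ℝ ↦ (1 / 2) * (t + (1 / 2) * δ)) (1 / 2) t := by
        simpa using ((hasDerivAt_id t).add_const ((1 / 2) * δ)).const_mul (1 / 2 : ℝ)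
      exact ((hσ.differentiable (by simp) _).hasDerivAt.comp t h1).deriv
    refine isMonodromy_perturbedForm (κ := κ) hα₀ hsm hg.1
      (hσ.comp (contDiff_const.mul (contDiff_id.add contDiff_const))) (fun t ↦ hσ01 _) hδ
      (hσ0 _ (by linarith)) (hσ1 _ (by linarith)) (fun t ht ↦ ?_) (fun t p ↦ ?_) hφ0 hφ
    · rw [hκd, deriv_eq_zero_of_step hσ0 hσ1, zero_mul]
      exact fun h1 ↦ ht ⟨by linarith [h1.1], by linarith [h1.2]⟩
    -- Here `χ(0) = 1` and `σ' = 2κ'` give the required values of `h` on the path.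
    · rw [hκd]
      simp [hh, cutoffHamiltonian, radialPath, hχ0, hκdef]
      exact Or.inl (by ring)
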